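/- Let $d\mu(z)=e^{-|z|^2}\,dx\,dy$ on $\mathbb{C}$, and write $\partial_z=\frac12(\partial_x-i\partial_y)$, $\partial_{\bar z}=\frac12(\partial_x+i\partial_y)$. For integers $m,n\ge 0$ let $$H_{m,n}(z,\bar z)=(-1)^{m+n}e^{|z|^2}\,\partial_{\bar z}^{m}\partial_z^{n}\bigl(e^{-|z|^2}\bigr)$$ be the Itô–Hermite polynomial (with leading term $z^m\bar z^n$). Let $$\mathcal{C}f(z)=\frac1\pi\int_{\mathbb{C}}\frac{f(\xi)}{z-\xi}\,d\mu(\xi)$$ be the Gaussian-weighted Cauchy transform. For $n\ge0$ let $\mathcal{A}^2_n\subset L^2(\mathbb{C},d\mu)$ be the true poly-Bargmann space, i.e. the space of all $f\in L^2(\mathbb{C},d\mu)$ satisfying $\Delta f=nf$ in the sense of distributions, where $\Delta=-\partial_z\partial_{\bar z}+\bar z\,\partial_{\bar z}$ is the Landau operator, and let $P_n$ be the orthogonal projection of $L^2(\mathbb{C},d\mu)$ onto $\mathcal{A}^2_n$. Then for all integers $n,j,k\ge 0$: $H_{j,k}\in L^2(\mathbb{C},d\mu)$, the integral defining $\mathcal{C}H_{j,k}(z)$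 converges absolutely for every $z\in\mathbb{C}$, $\mathcal{C}H_{j,k}\in L^2(\mathbb{C},d\mu)$, and, as elements of $L^2(\mathbb{C},d\mu)$, $$P_n(\mathcal{C}H_{j,k})=\begin{cases}\dfrac{(-1)^{n+k+1}\,(n+j-1)!}{2^{n+j}\,n!\,(n+j-k-1)!}\;H_{n+j-k-1,n}&\text{if } n+j\ge k+1,\\[2mm] 0&\text{if } n+j<k+1.\end{cases}$$ -/

import Mathlib

open MeasureTheory
open scoped ContDiff

/-- The Wirtinger derivative `∂/∂z = (∂/∂x - i ∂/∂y) / 2`. -/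
noncomputable def wirtingerDz (f : ℂ → ℂ) (z : ℂ) : ℂ :=
  (1 / 2) * (fderiv ℝ f z 1 - Complex.I * fderiv ℝ f z Complex.I)

/-- The Wirtinger derivative `∂/∂z̄ = (∂/∂x + i ∂/∂y) / 2`. -/
noncomputable def wirtingerDzbar (f : ℂ → ℂ) (z : ℂ) : ℂ :=
  (1 / 2) * (fderiv ℝ f z 1 + Complex.I * fderiv ℝ f z Complex.I)

/-- The Gaussian measure `dμ = exp(-|z|²) dx dy` on the complex plane (of total mass `π`). -/
noncomputable def gaussianMeasureC : Measure ℂ :=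
  (volume : Measure ℂ).withDensity (fun z => ENNReal.ofReal (Real.exp (-‖z‖ ^ 2)))

/-- The Itô–Hermite polynomial `H_{m,n}(z, z̄)`, by its Rodrigues formula
`(-1)^(m+n) exp(|z|²) ∂_z̄^m ∂_z^n exp(-|z|²)`; its leading term is `z^m z̄^n`. -/
noncomputable def itoHermite (m n : ℕ) (z : ℂ) : ℂ :=
  (-1) ^ (m + n) * ((Real.exp (‖z‖ ^ 2) : ℝ) : ℂ) *
    (wirtingerDzbar^[m] (wirtingerDz^[n] (fun w : ℂ => ((Real.exp (-‖w‖ ^ 2) : ℝ) : ℂ)))) z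

/-- The Gaussian-weighted Cauchy transform `C f(z) = (1/π) ∫ f(ξ) / (z - ξ) dμ(ξ)`. -/
noncomputable def cauchyTransform (f : ℂ → ℂ) (z : ℂ) : ℂ :=
  (1 / (Real.pi : ℂ)) * ∫ ξ, f ξ / (z - ξ) ∂gaussianMeasureC

/-- The Landau operator `Δ = ∂_z̄^* ∂_z̄ = (-∂_z + z̄) ∂_z̄`. -/
noncomputable def landauOp (f : ℂ → ℂ) (z : ℂ) : ℂ :=
  -wirtingerDz (wirtingerDzbar f) z + (starRingEnd ℂ) z * wirtingerDzbar f z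

/-- The true poly-Bargmann space `A²_n`: the `L²(μ)`-eigenspace of the Landau operator for the
eigenvalue `n`. As `Δ` is formally self-adjoint in `L²(μ)`, a function `f ∈ L²(μ)` satisfies
`Δ f = n f` in the sense of distributions if and only if `f` is orthogonal to `Δ φ - n φ` for
every smooth compactly supported `φ`. -/
noncomputable def polyBargmann (n : ℕ) : Submodule ℂ (Lp ℂ 2 gaussianMeasureC) :=
  (Submodule.span ℂ {u : Lp ℂ 2 gaussianMeasureC | ∃ φ : ℂ → ℂ,
    ContDiff ℝ ∞ φ ∧ HasCompactSupport φ ∧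
      u =ᵐ[gaussianMeasureC] fun z => landauOp φ z - (n : ℂ) * φ z})ᗮ

/-- The orthogonal projection `P_n` of `L²(μ)` onto `A²_n`. -/
noncomputable def polyBargmannProj (n : ℕ) :
    Lp ℂ 2 gaussianMeasureC →L[ℂ] Lp ℂ 2 gaussianMeasureC :=
  haveI : (polyBargmann n).HasOrthogonalProjection := by
    unfold polyBargmann; infer_instance
  (polyBargmann n).starProjection

/-!
Write `h_{m,n}` for the Itô–Hermite polynomials and `G = exp(-|z|²)`. Since
`∂̄ (h_{m,n} G) = -h_{m+1,n} G` and `∂̄ h_{m,n} = n h_{m,n-1}` (with the analogous rules for `∂`),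
integration by parts shows that the `h_{m,n}` are orthogonal in `L²(μ)`, with
`‖h_{m,n}‖² = π m! n!` (`itoPairing_one`), and that `h_{m,n}` lies in `A²_n`
(`itoLp_mem_polyBargmann`).

Conversely a function in `A²_n` is orthogonal to `h_{a,b}` for `b ≠ n`, as one sees by testing against
cut-offs of `h_{a,b}` (`inner_itoLp_of_mem_polyBargmann`). The `h_{a,b}` are complete, because the
Fourier transform of `f G` vanishes as soon as `f` is orthogonal to all polynomials
(`ae_eq_zero_of_integral_itoPoly_eq_zero`). Hence `A²_n` is the closed span of the `h_{m,n}`,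
`m ≥ 0`, and the projection onto it is determined by the coefficients along these functions
(`polyBargmannProj_eq_of_inner_eq`).

It remains to compute `⟨C h_{j,k}, h_{m,n}⟩`. For `j ≥ 1`, the Cauchy–Pompeiu formula applied to
`h_{j-1,k} G` gives `C h_{j,k} = -h_{j-1,k} G` (`cauchyTransform_itoPoly_succ`), so the coefficient
is an integral of two Itô–Hermite polynomials against `exp(-2|z|²)`, which integration by parts
evaluates (`itoPairing_two`). For `j = 0 < n` the antisymmetry of the Cauchy transform
(`integral_cauchyTransform_mul`) moves it onto `h_{n,m}` and reduces to the same integral. For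
`j = n = 0` the coefficient vanishes by rotation invariance.
-/

/-! ### Wirtinger derivatives -/

/-- `f` is real differentiable at `z` with `∂f/∂z = a` and `∂f/∂z̄ = b`, i.e. its differential is
`a dz + b dz̄`. -/
def HasWirtingerAt (f : ℂ → ℂ) (a b z : ℂ) : Prop :=
  HasFDerivAt f (a • ContinuousLinearMap.id ℝ ℂ + b • (Complex.conjCLE : ℂ →L[ℝ] ℂ)) z

theorem HasFDerivAt.hasWirtingerAt {f : ℂ → ℂ} {L : ℂ →L[ℝ] ℂ} {z : ℂ} (h : HasFDerivAt f L z) :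
    HasWirtingerAt f ((1 / 2) * (L 1 - Complex.I * L Complex.I))
      ((1 / 2) * (L 1 + Complex.I * L Complex.I)) z := by
  unfold HasWirtingerAt
  convert h using 1
  refine ContinuousLinearMap.ext fun v => ?_
  have hv : L v = v.re * L 1 + v.im * L Complex.I := by
    conv_lhs => rw [← Complex.re_add_im v]
    have e : (v.re : ℂ) + v.im * Complex.I = v.re • (1 : ℂ) + v.im • Complex.I := by simp
    rw [e, map_add, map_smul, map_smul]
    simp
  have h1 : (v.re : ℂ) = (v + (starRingEnd ℂ) v) / 2 := by
    rw [Complex.add_conj]; push_cast; ring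
  have h2 : (v.im : ℂ) = -Complex.I * (v - (starRingEnd ℂ) v) / 2 := by
    rw [Complex.sub_conj]; push_cast; linear_combination (v.im : ℂ) * Complex.I_sq
  simp only [add_apply, smul_apply,
    ContinuousLinearMap.id_apply, ContinuousLinearEquiv.coe_coe, Complex.conjCLE_apply,
    smul_eq_mul]
  rw [hv, h1, h2]
  ring

theorem DifferentiableAt.hasWirtingerAt {f : ℂ → ℂ} {z : ℂ} (h : DifferentiableAt ℝ f z) :
    HasWirtingerAt f (wirtingerDz f z) (wirtingerDzbar f z) z :=
  h.hasFDerivAt.hasWirtingerAt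

namespace HasWirtingerAt

variable {f g : ℂ → ℂ} {a b c d z : ℂ}

theorem congr_deriv (h : HasWirtingerAt f a b z) {a' b' : ℂ} (ha : a = a') (hb : b = b') :
    HasWirtingerAt f a' b' z := by subst ha hb; exact h

theorem wirtingerDz_eq (h : HasWirtingerAt f a b z) : wirtingerDz f z = a := by
  rw [wirtingerDz, HasFDerivAt.fderiv h]
  simp
  linear_combination (b / 2 - a / 2) * Complex.I_sq

theorem wirtingerDzbar_eq (h : HasWirtingerAt f a b z) : wirtingerDzbar f z = b := by
  rw [wirtingerDzbar, HasFDerivAt.fderiv h]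
  simp
  linear_combination (a / 2 - b / 2) * Complex.I_sq

theorem add (hf : HasWirtingerAt f a b z) (hg : HasWirtingerAt g c d z) :
    HasWirtingerAt (fun w => f w + g w) (a + c) (b + d) z := by
  refine (HasFDerivAt.add hf hg).congr_fderiv ?_
  ext; simp; ring

theorem mul (hf : HasWirtingerAt f a b z) (hg : HasWirtingerAt g c d z) :
    HasWirtingerAt (fun w => f w * g w) (a * g z + f z * c) (b * g z + f z * d) z := by
  refine (HasFDerivAt.mul hf hg).congr_fderiv ?_
  ext; simp; ring

theorem const (c z : ℂ) : HasWirtingerAt (fun _ => c) 0 0 z := by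
  refine (hasFDerivAt_const c z).congr_fderiv ?_
  ext; simp

theorem id (z : ℂ) : HasWirtingerAt (fun w => w) 1 0 z := by
  refine (hasFDerivAt_id (𝕜 := ℝ) z).congr_fderiv ?_
  simp

theorem conj (z : ℂ) : HasWirtingerAt (fun w => (starRingEnd ℂ) w) 0 1 z := by
  refine (Complex.conjCLE.hasFDerivAt (x := z)).congr_fderiv ?_
  simp

theorem const_mul (c : ℂ) (hf : HasWirtingerAt f a b z) :
    HasWirtingerAt (fun w => c * f w) (c * a) (c * b) z :=
  ((const c z).mul hf).congr_deriv (by ring) (by ring)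

theorem sub (hf : HasWirtingerAt f a b z) (hg : HasWirtingerAt g c d z) :
    HasWirtingerAt (fun w => f w - g w) (a - c) (b - d) z := by
  refine (HasFDerivAt.sub hf hg).congr_fderiv ?_
  ext; simp; ring

/-- Chain rule for an outer function of one real variable. -/
theorem ofReal_comp {u : ℂ → ℝ} {φ : ℝ → ℝ} {φ' : ℝ}
    (hu : HasWirtingerAt (fun w => (u w : ℂ)) a b z) (hφ : HasDerivAt φ φ' (u z)) :
    HasWirtingerAt (fun w => (φ (u w) : ℂ)) (φ' * a) (φ' * b) z := by
  have h1 : HasFDerivAt u (Complex.reCLM ∘L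
      (a • ContinuousLinearMap.id ℝ ℂ + b • (Complex.conjCLE : ℂ →L[ℝ] ℂ))) z := by
    have := (Complex.reCLM.hasFDerivAt (x := ((u z : ℝ) : ℂ))).comp z hu
    simpa [Function.comp_def] using this
  have h2 := Complex.ofRealCLM.hasFDerivAt.comp z h1
  -- the differential of a real-valued function is real-valued
  have hre : ∀ v, ((a * v + b * (starRingEnd ℂ) v).re : ℂ) = a * v + b * (starRingEnd ℂ) v := by
    intro v
    have := HasFDerivAt.unique hu h2
    have := congrArg (fun L : ℂ →L[ℝ] ℂ => L v) this
    simp at this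
    simpa using this.symm
  have h3 := Complex.ofRealCLM.hasFDerivAt.comp z (hφ.hasFDerivAt.comp z h1)
  refine HasFDerivAt.congr_fderiv h3 ?_
  refine ContinuousLinearMap.ext fun v => ?_
  have := hre v
  simp only [add_apply, smul_apply,
    ContinuousLinearMap.id_apply, ContinuousLinearEquiv.coe_coe, Complex.conjCLE_apply,
    smul_eq_mul, ContinuousLinearMap.comp_apply, Complex.reCLM_apply, Complex.ofRealCLM_apply,
    ContinuousLinearMap.toSpanSingleton_apply, Complex.ofReal_mul]
  linear_combination (φ' : ℂ) * this

theorem continuousAt (hf : HasWirtingerAt f a b z) : ContinuousAt f z :=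
  HasFDerivAt.continuousAt hf

end HasWirtingerAt

theorem hasWirtingerAt_normSq (z : ℂ) :
    HasWirtingerAt (fun w => ((‖w‖ ^ 2 : ℝ) : ℂ)) ((starRingEnd ℂ) z) z z := by
  have := (HasWirtingerAt.id z).mul (HasWirtingerAt.conj z)
  simp only [Complex.mul_conj, Complex.normSq_eq_norm_sq] at this
  exact this.congr_deriv (by simp) (by simp)

/-- The Gaussian `exp(-c|z|²)`, as a complex-valued function. -/
noncomputable def gaussC (c : ℝ) (z : ℂ) : ℂ := ((Real.exp (-(c * ‖z‖ ^ 2)) : ℝ) : ℂ)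

theorem hasWirtingerAt_gaussC (c : ℝ) (z : ℂ) :
    HasWirtingerAt (gaussC c) (-c * (starRingEnd ℂ) z * gaussC c z) (-c * z * gaussC c z) z := by
  have h : HasDerivAt (fun t : ℝ => Real.exp (-(c * t)))
      (Real.exp (-(c * ‖z‖ ^ 2)) * -(c * 1)) (‖z‖ ^ 2) :=
    (((hasDerivAt_id (‖z‖ ^ 2)).const_mul c).neg).exp
  refine ((hasWirtingerAt_normSq z).ofReal_comp h).congr_deriv ?_ ?_ <;>
  · simp only [gaussC]; push_cast; ring

theorem continuous_gaussC (c : ℝ) : Continuous (gaussC c) := by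
  unfold gaussC; fun_prop

theorem norm_gaussC (c : ℝ) (z : ℂ) : ‖gaussC c z‖ = Real.exp (-(c * ‖z‖ ^ 2)) := by
  simp [gaussC, abs_of_pos (Real.exp_pos _), -Complex.ofReal_exp]

theorem gaussC_add (c d : ℝ) (z : ℂ) : gaussC (c + d) z = gaussC c z * gaussC d z := by
  unfold gaussC
  rw [← Complex.ofReal_mul, ← Real.exp_add]
  congr 2; ring

/-! ### The Itô–Hermite polynomials -/

/-- The Itô–Hermite polynomial in `z, z̄`, by its recursion in the first index. For `n = 0` the
truncated index `n - 1` is harmless because of the factor `n`. -/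
noncomputable def itoPoly : ℕ → ℕ → ℂ → ℂ
  | 0, n, z => (starRingEnd ℂ) z ^ n
  | m + 1, n, z => z * itoPoly m n z - n * itoPoly m (n - 1) z

theorem itoPoly_zero_left (n : ℕ) (z : ℂ) : itoPoly 0 n z = (starRingEnd ℂ) z ^ n := rfl

theorem itoPoly_succ_left (m n : ℕ) (z : ℂ) :
    itoPoly (m + 1) n z = z * itoPoly m n z - n * itoPoly m (n - 1) z := rfl

theorem itoPoly_succ_right (m n : ℕ) (z : ℂ) :
    itoPoly m (n + 1) z = (starRingEnd ℂ) z * itoPoly m n z - m * itoPoly (m - 1) n z := by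
  induction m generalizing n with
  | zero => simp [itoPoly, pow_succ, mul_comm]
  | succ m ih =>
    rcases n with _ | n
    · have e1 := itoPoly_succ_left m 1 z
      have e2 := ih 0
      have e3 := itoPoly_succ_left m 0 z
      rcases m with _ | m
      · simp [itoPoly, mul_comm]
      · have e4 := itoPoly_succ_left m 0 z
        simp at e1 e2 e3 e4 ⊢
        linear_combination e1 + z * e2 - (starRingEnd ℂ) z * e3 + (m + 1) * e4
    · have e1 := itoPoly_succ_left m (n + 2) z
      have e2 := ih (n + 1)
      have e3 := itoPoly_succ_left m (n + 1) z
      have e5 := ih n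
      rcases m with _ | m
      · simp [itoPoly]; ring
      · have e4 := itoPoly_succ_left m (n + 1) z
        simp at e1 e2 e3 e4 e5 ⊢
        linear_combination e1 + z * e2 - (starRingEnd ℂ) z * e3 + (m + 1) * e4 - (n + 1) * e5

theorem itoPoly_zero_right (m : ℕ) (z : ℂ) : itoPoly m 0 z = z ^ m := by
  induction m with
  | zero => simp [itoPoly]
  | succ m ih => simp [itoPoly_succ_left, ih, pow_succ, mul_comm]

theorem conj_itoPoly (m n : ℕ) (z : ℂ) :
    (starRingEnd ℂ) (itoPoly m n z) = itoPoly n m z := by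
  induction m generalizing n with
  | zero => simp [itoPoly_zero_left, itoPoly_zero_right]
  | succ m ih => simp [itoPoly_succ_left, itoPoly_succ_right, ih]

theorem hasWirtingerAt_itoPoly (m n : ℕ) (z : ℂ) :
    HasWirtingerAt (itoPoly m n) (m * itoPoly (m - 1) n z) (n * itoPoly m (n - 1) z) z := by
  induction m generalizing n with
  | zero =>
    have : ∀ n : ℕ, HasWirtingerAt (itoPoly 0 n) 0 (n * itoPoly 0 (n - 1) z) z := by
      intro n
      induction n with
      | zero => simpa [itoPoly] using HasWirtingerAt.const 1 z
      | succ n ih =>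
        have h := ih.mul (HasWirtingerAt.conj z)
        have e : (fun w => itoPoly 0 n w * (starRingEnd ℂ) w) = itoPoly 0 (n + 1) := by
          funext w; simp [itoPoly, pow_succ]
        rw [e] at h
        refine h.congr_deriv (by simp) ?_
        rcases n with _ | n
        · simp [itoPoly]
        · simp [itoPoly]; ring
    simpa using this n
  | succ m ih =>
    have h := ((HasWirtingerAt.id z).mul (ih n)).sub ((ih (n - 1)).const_mul n)
    refine HasWirtingerAt.congr_deriv h ?_ ?_
    · rcases m with _ | m
      · simp
      · simp only [Nat.add_sub_cancel]
        rw [itoPoly_succ_left m]; push_cast; ring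
    · rw [itoPoly_succ_left]
      ring

/-- `h e^{-|z|²}` behaves under `∂` and `∂̄` by raising one index. -/
theorem hasWirtingerAt_itoPoly_mul_gaussC (m n : ℕ) (z : ℂ) :
    HasWirtingerAt (fun w => itoPoly m n w * gaussC 1 w) (-(itoPoly m (n + 1) z * gaussC 1 z))
      (-(itoPoly (m + 1) n z * gaussC 1 z)) z := by
  refine ((hasWirtingerAt_itoPoly m n z).mul (hasWirtingerAt_gaussC 1 z)).congr_deriv ?_ ?_
  · rw [itoPoly_succ_right]; push_cast; ring
  · rw [itoPoly_succ_left]; push_cast; ring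

theorem continuous_itoPoly (m n : ℕ) : Continuous (itoPoly m n) :=
  continuous_iff_continuousAt.2 fun z => (hasWirtingerAt_itoPoly m n z).continuousAt

theorem wirtinger_iterate_gaussian (m n : ℕ) :
    wirtingerDzbar^[m] (wirtingerDz^[n] (fun w : ℂ => ((Real.exp (-‖w‖ ^ 2) : ℝ) : ℂ))) =
      fun z => (-1) ^ (m + n) * (itoPoly m n z * gaussC 1 z) := by
  induction m with
  | zero =>
    induction n with
    | zero => funext z; simp [itoPoly, gaussC]
    | succ n ih =>
      rw [Function.iterate_zero, id] at ih ⊢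
      rw [Function.iterate_succ_apply', ih]
      funext z
      rw [((hasWirtingerAt_itoPoly_mul_gaussC 0 n z).const_mul _).wirtingerDz_eq]
      ring
  | succ m ih =>
    rw [Function.iterate_succ_apply', ih]
    funext z
    rw [((hasWirtingerAt_itoPoly_mul_gaussC m n z).const_mul _).wirtingerDzbar_eq]
    ring

theorem itoHermite_eq_itoPoly (m n : ℕ) : itoHermite m n = itoPoly m n := by
  funext z
  have h : ((Real.exp (‖z‖ ^ 2) : ℝ) : ℂ) * gaussC 1 z = 1 := by
    rw [gaussC, ← Complex.ofReal_mul, ← Real.exp_add]; simp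
  rw [itoHermite, wirtinger_iterate_gaussian]
  have h2 : ((-1 : ℂ) ^ (m + n)) * (-1) ^ (m + n) = 1 := by
    rw [← mul_pow]; simp
  linear_combination itoPoly m n z * ((-1 : ℂ) ^ (m + n) * (-1) ^ (m + n)) * h + itoPoly m n z * h2

/-! ### Gaussian integrals of functions of exponential growth -/

/-- A continuous function on `ℂ` of at most exponential growth. Polynomials in `z, z̄`, their
products with characters, and compactly supported continuous functions are of this kind; all are
integrable against every Gaussian. -/
structure ExpGrowth (f : ℂ → ℂ) : Prop where
  continuous : Continuous f
  bound : ∃ C a : ℝ, 0 ≤ C ∧ 0 ≤ a ∧ ∀ z, ‖f z‖ ≤ C * Real.exp (a * ‖z‖)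

namespace ExpGrowth

variable {f g : ℂ → ℂ}

theorem of_bounded (hf : Continuous f) {C : ℝ} (h : ∀ z, ‖f z‖ ≤ C) : ExpGrowth f :=
  ⟨hf, C, 0, (norm_nonneg _).trans (h 0), le_rfl, fun z => by simpa using h z⟩

theorem of_hasCompactSupport (hf : Continuous f) (h : HasCompactSupport f) : ExpGrowth f := by
  obtain ⟨C, hC⟩ := h.exists_bound_of_continuous hf
  exact of_bounded hf hC

theorem const (c : ℂ) : ExpGrowth fun _ => c :=
  of_bounded continuous_const (C := ‖c‖) fun _ => le_rfl

theorem id : ExpGrowth fun z => z :=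
  ⟨continuous_id, 1, 1, zero_le_one, zero_le_one, fun z => by
    linarith [Real.add_one_le_exp (1 * ‖z‖)]⟩

theorem conj (hf : ExpGrowth f) : ExpGrowth fun z => (starRingEnd ℂ) (f z) := by
  obtain ⟨C, a, hC, ha, h⟩ := hf.bound
  exact ⟨Complex.continuous_conj.comp hf.continuous, C, a, hC, ha, fun z => by simpa using h z⟩

theorem mul (hf : ExpGrowth f) (hg : ExpGrowth g) : ExpGrowth fun z => f z * g z := by
  obtain ⟨C, a, hC, ha, h⟩ := hf.bound
  obtain ⟨D, b, hD, hb, k⟩ := hg.bound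
  refine ⟨hf.continuous.mul hg.continuous, C * D, a + b, by positivity, by positivity, fun z => ?_⟩
  rw [norm_mul, add_mul, Real.exp_add]
  calc ‖f z‖ * ‖g z‖ ≤ (C * Real.exp (a * ‖z‖)) * (D * Real.exp (b * ‖z‖)) :=
        mul_le_mul (h z) (k z) (norm_nonneg _) (by positivity)
    _ = _ := by ring

theorem add (hf : ExpGrowth f) (hg : ExpGrowth g) : ExpGrowth fun z => f z + g z := by
  obtain ⟨C, a, hC, ha, h⟩ := hf.bound
  obtain ⟨D, b, hD, hb, k⟩ := hg.bound
  refine ⟨hf.continuous.add hg.continuous, C + D, a + b, by positivity, by positivity, fun z => ?_⟩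
  have h1 : Real.exp (a * ‖z‖) ≤ Real.exp ((a + b) * ‖z‖) := by gcongr; linarith
  have h2 : Real.exp (b * ‖z‖) ≤ Real.exp ((a + b) * ‖z‖) := by gcongr; linarith
  calc ‖f z + g z‖ ≤ C * Real.exp (a * ‖z‖) + D * Real.exp (b * ‖z‖) :=
        (norm_add_le _ _).trans (add_le_add (h z) (k z))
    _ ≤ C * Real.exp ((a + b) * ‖z‖) + D * Real.exp ((a + b) * ‖z‖) := by gcongr
    _ = _ := by ring

theorem const_mul (c : ℂ) (hf : ExpGrowth f) : ExpGrowth fun z => c * f z := (const c).mul hf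

theorem sub (hf : ExpGrowth f) (hg : ExpGrowth g) : ExpGrowth fun z => f z - g z := by
  simpa [sub_eq_add_neg] using hf.add (hg.const_mul (-1))

theorem pow (hf : ExpGrowth f) (n : ℕ) : ExpGrowth fun z => f z ^ n := by
  induction n with
  | zero => simpa using const 1
  | succ n ih => simpa [pow_succ] using ih.mul hf

end ExpGrowth

theorem expGrowth_itoPoly (m n : ℕ) : ExpGrowth (itoPoly m n) := by
  induction m generalizing n with
  | zero => exact ExpGrowth.id.conj.pow n
  | succ m ih => exact (ExpGrowth.id.mul (ih n)).sub ((ih (n - 1)).const_mul n)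

theorem integrable_exp_neg_mul_normSq {c : ℝ} (hc : 0 < c) :
    Integrable fun z : ℂ => Real.exp (-(c * ‖z‖ ^ 2)) := by
  have h := GaussianFourier.integrable_cexp_neg_mul_sq_norm_add (V := ℂ) (b := (c : ℂ))
    (by simpa using hc) 0 0
  refine h.re.congr (Filter.Eventually.of_forall fun z => ?_)
  simp only [inner_zero_left, Complex.ofReal_zero, mul_zero, add_zero]
  rw [← Complex.exp_ofReal_re]
  push_cast
  simp

theorem ExpGrowth.norm_mul_gaussC_le {f : ℂ → ℂ} (hf : ExpGrowth f) {c : ℝ} (hc : 0 < c) :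
    ∃ C : ℝ, 0 ≤ C ∧ ∀ z, ‖f z * gaussC c z‖ ≤ C * Real.exp (-(c / 2 * ‖z‖ ^ 2)) := by
  obtain ⟨C, a, hC, ha, h⟩ := hf.bound
  refine ⟨C * Real.exp (a ^ 2 / (2 * c)), by positivity, fun z => ?_⟩
  rw [norm_mul, norm_gaussC, mul_assoc, ← Real.exp_add]
  calc ‖f z‖ * Real.exp (-(c * ‖z‖ ^ 2))
      ≤ C * Real.exp (a * ‖z‖) * Real.exp (-(c * ‖z‖ ^ 2)) := by gcongr; exact h z
    _ = C * Real.exp (a * ‖z‖ + -(c * ‖z‖ ^ 2)) := by rw [mul_assoc, ← Real.exp_add]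
    _ ≤ _ := by
      refine mul_le_mul_of_nonneg_left (Real.exp_le_exp.2 ?_) hC
      -- completing the square
      have : a ^ 2 / (2 * c) + -(c / 2 * ‖z‖ ^ 2) - (a * ‖z‖ + -(c * ‖z‖ ^ 2)) =
          (a - c * ‖z‖) ^ 2 / (2 * c) := by field_simp; ring
      have h0 : 0 ≤ (a - c * ‖z‖) ^ 2 / (2 * c) := by positivity
      linarith

theorem ExpGrowth.integrable_mul_gaussC {f : ℂ → ℂ} (hf : ExpGrowth f) {c : ℝ} (hc : 0 < c) :
    Integrable fun z => f z * gaussC c z := by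
  obtain ⟨C, -, h⟩ := hf.norm_mul_gaussC_le hc
  exact ((integrable_exp_neg_mul_normSq (half_pos hc)).const_mul C).mono'
    (hf.continuous.mul (continuous_gaussC c)).aestronglyMeasurable (Filter.Eventually.of_forall h)

theorem integral_gaussC {c : ℝ} (hc : 0 < c) : ∫ z, gaussC c z = Real.pi / c := by
  have h := GaussianFourier.integral_rexp_neg_mul_sq_norm (V := ℂ) hc
  simp only [Complex.finrank_real_complex, Nat.cast_ofNat, div_self (two_ne_zero' ℝ),
    Real.rpow_one, neg_mul] at h
  unfold gaussC
  rw [integral_complex_ofReal, h]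
  push_cast; rfl

/-- The integral over the plane of a Wirtinger derivative vanishes, provided everything is
integrable. -/
theorem integral_wirtinger_eq_zero {f a b : ℂ → ℂ} (hf : Integrable f) (ha : Integrable a)
    (hb : Integrable b) (h : ∀ z, HasWirtingerAt f (a z) (b z) z) :
    ∫ z, a z = 0 ∧ ∫ z, b z = 0 := by
  have key : ∀ v : ℂ, (∫ z, a z) * v + (∫ z, b z) * (starRingEnd ℂ) v = 0 := by
    intro v
    have hv : Integrable fun z => a z * v + b z * (starRingEnd ℂ) v :=
      (ha.mul_const _).add (hb.mul_const _)
    have := integral_bilinear_hasFDerivAt_right_eq_neg_left_of_integrable (μ := (volume : Measure ℂ))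
      (f := fun _ => (1 : ℂ)) (f' := fun _ => 0) (g := f) (v := v)
      (g' := fun z => a z • ContinuousLinearMap.id ℝ ℂ + b z • (Complex.conjCLE : ℂ →L[ℝ] ℂ))
      (B := ContinuousLinearMap.mul ℝ ℂ) (by simp) (by simpa using hv) (by simpa using hf)
      (fun z _ => hasFDerivAt_const _ _) (fun z _ => h z)
    simp only [ContinuousLinearMap.mul_apply', one_mul, add_apply, smul_apply,
      ContinuousLinearMap.id_apply, ContinuousLinearEquiv.coe_coe, Complex.conjCLE_apply,
      smul_eq_mul, zero_apply, zero_mul, integral_zero, neg_zero] at this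
    rwa [integral_add (ha.mul_const _) (hb.mul_const _), integral_mul_const,
      integral_mul_const] at this
  have h1 := key 1
  have h2 := key Complex.I
  simp only [map_one, mul_one, Complex.conj_I] at h1 h2
  constructor
  · linear_combination (1 / 2) * h1 - Complex.I / 2 * h2 +
      ((∫ z, a z) / 2 - (∫ z, b z) / 2) * Complex.I_sq
  · linear_combination (1 / 2) * h1 + Complex.I / 2 * h2 -
      ((∫ z, a z) / 2 - (∫ z, b z) / 2) * Complex.I_sq

/-- Integration by parts against the Gaussian `e^{-c|z|²}`. -/
theorem integral_wirtinger_gaussC {f a b : ℂ → ℂ} (hf : ExpGrowth f) (ha : ExpGrowth a)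
    (hb : ExpGrowth b) (h : ∀ z, HasWirtingerAt f (a z) (b z) z) {c : ℝ} (hc : 0 < c) :
    ∫ z, (a z - c * (starRingEnd ℂ) z * f z) * gaussC c z = 0 ∧
      ∫ z, (b z - c * z * f z) * gaussC c z = 0 :=
  integral_wirtinger_eq_zero (hf.integrable_mul_gaussC hc)
    ((ha.sub ((ExpGrowth.id.conj.const_mul c).mul hf)).integrable_mul_gaussC hc)
    ((hb.sub ((ExpGrowth.id.const_mul c).mul hf)).integrable_mul_gaussC hc)
    fun z => ((h z).mul (hasWirtingerAt_gaussC c z)).congr_deriv (by ring) (by ring)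

/-! ### Pairings of Itô–Hermite polynomials -/

/-- The bilinear pairing of two Itô–Hermite polynomials against `e^{-c|z|²}`. -/
noncomputable def itoPairing (c : ℝ) (m n p q : ℕ) : ℂ :=
  ∫ z, itoPoly m n z * itoPoly p q z * gaussC c z

theorem itoPairing_comm (c : ℝ) (m n p q : ℕ) : itoPairing c m n p q = itoPairing c p q m n := by
  simp only [itoPairing, mul_comm (itoPoly m n _)]

theorem itoPairing_integration_by_parts {c : ℝ} (hc : 0 < c) (m n p q : ℕ) :
    (∫ z, (m * itoPoly (m - 1) n z * itoPoly p q z + itoPoly m n z * (p * itoPoly (p - 1) q z)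
      - c * (starRingEnd ℂ) z * (itoPoly m n z * itoPoly p q z)) * gaussC c z) = 0 ∧
    (∫ z, (n * itoPoly m (n - 1) z * itoPoly p q z + itoPoly m n z * (q * itoPoly p (q - 1) z)
      - c * z * (itoPoly m n z * itoPoly p q z)) * gaussC c z) = 0 := by
  have G := expGrowth_itoPoly
  exact integral_wirtinger_gaussC ((G m n).mul (G p q))
    ((((G _ _).const_mul _).mul (G _ _)).add ((G _ _).mul ((G _ _).const_mul _)))
    ((((G _ _).const_mul _).mul (G _ _)).add ((G _ _).mul ((G _ _).const_mul _)))
    (fun z => (hasWirtingerAt_itoPoly m n z).mul (hasWirtingerAt_itoPoly p q z)) hc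

theorem integrable_itoPairing {c : ℝ} (hc : 0 < c) (m n p q : ℕ) :
    Integrable fun z => itoPoly m n z * itoPoly p q z * gaussC c z :=
  ((expGrowth_itoPoly m n).mul (expGrowth_itoPoly p q)).integrable_mul_gaussC hc

/-- Integrating `∂̄ (h_{m,n} h_{p,q} G) = h_{m,n} q h_{p,q-1} G - h_{m+1,n} h_{p,q} G`. -/
theorem itoPairing_one_succ_left (m n p q : ℕ) :
    itoPairing 1 (m + 1) n p q = q * itoPairing 1 m n p (q - 1) := by
  have h := (itoPairing_integration_by_parts one_pos m n p q).2
  have e : ∀ z, (n * itoPoly m (n - 1) z * itoPoly p q z + itoPoly m n z * (q * itoPoly p (q - 1) z)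
      - (1 : ℝ) * z * (itoPoly m n z * itoPoly p q z)) * gaussC 1 z =
      q * (itoPoly m n z * itoPoly p (q - 1) z * gaussC 1 z) -
        itoPoly (m + 1) n z * itoPoly p q z * gaussC 1 z := fun z => by
    rw [itoPoly_succ_left]; push_cast; ring
  simp only [e] at h
  rw [integral_sub ((integrable_itoPairing one_pos _ _ _ _).const_mul _)
    (integrable_itoPairing one_pos _ _ _ _), integral_const_mul] at h
  exact (sub_eq_zero.1 h).symm

theorem itoPairing_one_succ_right (m n p q : ℕ) :
    itoPairing 1 m (n + 1) p q = p * itoPairing 1 m n (p - 1) q := by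
  have h := (itoPairing_integration_by_parts one_pos m n p q).1
  have e : ∀ z, (m * itoPoly (m - 1) n z * itoPoly p q z + itoPoly m n z * (p * itoPoly (p - 1) q z)
      - (1 : ℝ) * (starRingEnd ℂ) z * (itoPoly m n z * itoPoly p q z)) * gaussC 1 z =
      p * (itoPoly m n z * itoPoly (p - 1) q z * gaussC 1 z) -
        itoPoly m (n + 1) z * itoPoly p q z * gaussC 1 z := fun z => by
    rw [itoPoly_succ_right]; push_cast; ring
  simp only [e] at h
  rw [integral_sub ((integrable_itoPairing one_pos _ _ _ _).const_mul _)
    (integrable_itoPairing one_pos _ _ _ _), integral_const_mul] at h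
  exact (sub_eq_zero.1 h).symm

/-- Orthogonality in `L²(μ)`; recall that `itoPoly q p` is the conjugate of `itoPoly p q`. -/
theorem itoPairing_one (m n p q : ℕ) :
    itoPairing 1 m n p q = if m = q ∧ n = p then (m.factorial * n.factorial * Real.pi : ℂ) else 0 := by
  induction m generalizing q with
  | zero =>
    induction n generalizing p with
    | zero =>
      rw [itoPairing_comm]
      rcases p with _ | p
      · rcases q with _ | q
        · have := integral_gaussC one_pos
          simpa [itoPairing, itoPoly] using this
        · rw [itoPairing_one_succ_right]; simp
      · rw [itoPairing_one_succ_left]; simp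
    | succ n ih =>
      rw [itoPairing_one_succ_right, ih]
      rcases p with _ | p
      · simp
      · simp only [Nat.add_sub_cancel, add_left_inj]
        split_ifs with h
        · rw [h.2, Nat.factorial_succ]; push_cast; ring
        · simp
  | succ m ih =>
    rw [itoPairing_one_succ_left, ih]
    rcases q with _ | q
    · simp
    · simp only [Nat.add_sub_cancel, add_left_inj]
      split_ifs with h
      · rw [h.1, Nat.factorial_succ]; push_cast; ring
      · simp

theorem itoPairing_two_succ_left (m n p q : ℕ) :
    itoPairing 2 (m + 1) n p q = -itoPairing 2 m n (p + 1) q := by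
  have h := (itoPairing_integration_by_parts two_pos m n p q).2
  have e : ∀ z, (n * itoPoly m (n - 1) z * itoPoly p q z + itoPoly m n z * (q * itoPoly p (q - 1) z)
      - (2 : ℝ) * z * (itoPoly m n z * itoPoly p q z)) * gaussC 2 z =
      -1 * (itoPoly m n z * itoPoly (p + 1) q z * gaussC 2 z) -
        itoPoly (m + 1) n z * itoPoly p q z * gaussC 2 z := fun z => by
    rw [itoPoly_succ_left, itoPoly_succ_left]; push_cast; ring
  simp only [e] at h
  rw [integral_sub ((integrable_itoPairing two_pos _ _ _ _).const_mul _)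
    (integrable_itoPairing two_pos _ _ _ _), integral_const_mul] at h
  change -1 * itoPairing 2 m n (p + 1) q - itoPairing 2 (m + 1) n p q = 0 at h
  linear_combination -h

theorem itoPairing_two_succ_right (m n p q : ℕ) :
    itoPairing 2 m (n + 1) p q = -itoPairing 2 m n p (q + 1) := by
  have h := (itoPairing_integration_by_parts two_pos m n p q).1
  have e : ∀ z, (m * itoPoly (m - 1) n z * itoPoly p q z + itoPoly m n z * (p * itoPoly (p - 1) q z)
      - (2 : ℝ) * (starRingEnd ℂ) z * (itoPoly m n z * itoPoly p q z)) * gaussC 2 z =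
      -1 * (itoPoly m n z * itoPoly p (q + 1) z * gaussC 2 z) -
        itoPoly m (n + 1) z * itoPoly p q z * gaussC 2 z := fun z => by
    rw [itoPoly_succ_right, itoPoly_succ_right]; push_cast; ring
  simp only [e] at h
  rw [integral_sub ((integrable_itoPairing two_pos _ _ _ _).const_mul _)
    (integrable_itoPairing two_pos _ _ _ _), integral_const_mul] at h
  change -1 * itoPairing 2 m n p (q + 1) - itoPairing 2 m (n + 1) p q = 0 at h
  linear_combination -h

/-- Against `e^{-2|z|²}` all derivatives can be moved onto the second factor. -/
theorem itoPairing_two_eq_shift (m n p q : ℕ) :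
    itoPairing 2 m n p q = (-1) ^ (m + n) * itoPairing 2 0 0 (m + p) (n + q) := by
  induction m generalizing p with
  | zero =>
    induction n generalizing q with
    | zero => simp
    | succ n ih =>
      rw [itoPairing_two_succ_right, ih, show n + (q + 1) = n + 1 + q by ring]
      ring
  | succ m ih =>
    rw [itoPairing_two_succ_left, ih, show m + (p + 1) = m + 1 + p by ring]
    ring

theorem itoPairing_two_zero_left_rec (p q : ℕ) :
    itoPairing 2 0 0 (p + 1) q = -(q / 2) * itoPairing 2 0 0 p (q - 1) := by
  have h := (itoPairing_integration_by_parts two_pos 0 0 p q).2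
  have e : ∀ z, ((0 : ℕ) * itoPoly 0 (0 - 1) z * itoPoly p q z +
      itoPoly 0 0 z * (q * itoPoly p (q - 1) z)
      - (2 : ℝ) * z * (itoPoly 0 0 z * itoPoly p q z)) * gaussC 2 z =
      -q * (itoPoly 0 0 z * itoPoly p (q - 1) z * gaussC 2 z) -
        2 * (itoPoly 0 0 z * itoPoly (p + 1) q z * gaussC 2 z) := fun z => by
    rw [itoPoly_succ_left]; push_cast; ring
  simp only [e] at h
  rw [integral_sub ((integrable_itoPairing two_pos _ _ _ _).const_mul _)
    ((integrable_itoPairing two_pos _ _ _ _).const_mul _), integral_const_mul,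
    integral_const_mul] at h
  change -q * itoPairing 2 0 0 p (q - 1) - 2 * itoPairing 2 0 0 (p + 1) q = 0 at h
  linear_combination (-1 / 2) * h

theorem itoPairing_two_zero_zero_left (p q : ℕ) :
    itoPairing 2 0 0 p q =
      if p = q then ((-1 / 2) ^ p * p.factorial * (Real.pi / 2) : ℂ) else 0 := by
  induction p generalizing q with
  | zero =>
    rcases q with _ | q
    · have := integral_gaussC two_pos
      simpa [itoPairing, itoPoly] using this
    · -- here `h_{0,q+1} = z̄^{q+1}` and `z̄ e^{-2|z|²}` is a multiple of `∂ e^{-2|z|²}`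
      have h := (itoPairing_integration_by_parts two_pos 0 0 0 q).1
      have e : ∀ z, ((0 : ℕ) * itoPoly (0 - 1) 0 z * itoPoly 0 q z +
          itoPoly 0 0 z * ((0 : ℕ) * itoPoly (0 - 1) q z)
          - (2 : ℝ) * (starRingEnd ℂ) z * (itoPoly 0 0 z * itoPoly 0 q z)) * gaussC 2 z =
          -2 * (itoPoly 0 0 z * itoPoly 0 (q + 1) z * gaussC 2 z) := fun z => by
        rw [itoPoly_succ_right]; push_cast; ring
      simp only [e] at h
      rw [integral_const_mul] at h
      have h' : itoPairing 2 0 0 0 (q + 1) = 0 := by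
        simpa [itoPairing] using h
      simp [h']
  | succ p ih =>
    rw [itoPairing_two_zero_left_rec, ih]
    rcases q with _ | q
    · simp
    · simp only [Nat.add_sub_cancel, add_left_inj]
      split_ifs with h
      · rw [h, Nat.factorial_succ]; push_cast; ring
      · simp

theorem itoPairing_two (m n p q : ℕ) :
    itoPairing 2 m n p q = if m + p = n + q then
      ((-1) ^ (m + n) * (-1 / 2) ^ (m + p) * (m + p).factorial * (Real.pi / 2) : ℂ) else 0 := by
  rw [itoPairing_two_eq_shift, itoPairing_two_zero_zero_left]
  split_ifs <;> ring

/-! ### The Gaussian measure -/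

theorem measurable_gaussDensity :
    Measurable fun z : ℂ => ENNReal.ofReal (Real.exp (-‖z‖ ^ 2)) := by fun_prop

theorem integral_gaussianMeasureC (g : ℂ → ℂ) :
    ∫ z, g z ∂gaussianMeasureC = ∫ z, g z * gaussC 1 z := by
  rw [gaussianMeasureC, integral_withDensity_eq_integral_toReal_smul measurable_gaussDensity
    (Filter.Eventually.of_forall fun _ => ENNReal.ofReal_lt_top)]
  refine integral_congr_ae (Filter.Eventually.of_forall fun z => ?_)
  simp only [ENNReal.toReal_ofReal (Real.exp_pos _).le, gaussC, Complex.real_smul, one_mul]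
  ring

theorem integrable_gaussianMeasureC_iff (g : ℂ → ℂ) :
    Integrable g gaussianMeasureC ↔ Integrable fun z => g z * gaussC 1 z := by
  rw [gaussianMeasureC, integrable_withDensity_iff_integrable_smul' measurable_gaussDensity
    (Filter.Eventually.of_forall fun _ => ENNReal.ofReal_lt_top)]
  refine integrable_congr (Filter.Eventually.of_forall fun z => ?_)
  simp only [ENNReal.toReal_ofReal (Real.exp_pos _).le, gaussC, Complex.real_smul, one_mul]
  ring

theorem ExpGrowth.integrable {f : ℂ → ℂ} (hf : ExpGrowth f) : Integrable f gaussianMeasureC :=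
  (integrable_gaussianMeasureC_iff f).2 (hf.integrable_mul_gaussC one_pos)

theorem ExpGrowth.memLp {f : ℂ → ℂ} (hf : ExpGrowth f) : MemLp f 2 gaussianMeasureC := by
  rw [memLp_two_iff_integrable_sq_norm hf.continuous.aestronglyMeasurable]
  refine (hf.mul hf).integrable.norm.congr (Filter.Eventually.of_forall fun z => ?_)
  simp [sq]

theorem MeasureTheory.MemLp.integrable_mul_expGrowth {u g : ℂ → ℂ}
    (hu : MemLp u 2 gaussianMeasureC) (hg : ExpGrowth g) :
    Integrable (fun z => u z * g z) gaussianMeasureC :=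
  hu.integrable_mul hg.memLp

instance : IsFiniteMeasure gaussianMeasureC := by
  have h := (ExpGrowth.const 1).integrable
  exact (integrable_const_iff_isFiniteMeasure one_ne_zero).1 h

theorem ae_gaussianMeasureC_iff {p : ℂ → Prop} :
    (∀ᵐ z ∂gaussianMeasureC, p z) ↔ ∀ᵐ z, p z := by
  refine ⟨fun h => ?_, fun h => (withDensity_absolutelyContinuous _ _).ae_le h⟩
  refine (withDensity_absolutelyContinuous' measurable_gaussDensity.aemeasurable ?_).ae_le h
  exact Filter.Eventually.of_forall fun z => by simp [Real.exp_pos]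

/-! ### Completeness of the Itô–Hermite polynomials -/

section Completeness

open scoped FourierTransform RealInnerProductSpace

/-- An integrable function whose Fourier transform vanishes is zero. -/
theorem ae_eq_zero_of_fourier_eq_zero {F : ℂ → ℂ} (hF : Integrable F) (h : 𝓕 F = 0) :
    ∀ᵐ z, F z = 0 := by
  refine ae_eq_zero_of_integral_contDiff_smul_eq_zero hF.locallyIntegrable fun g hg hgs => ?_
  have hs : HasCompactSupport fun z => (g z : ℂ) := hgs.comp_left (g := Complex.ofReal) rfl
  let φ : SchwartzMap ℂ ℂ := hs.toSchwartzMap (Complex.ofRealCLM.contDiff.comp hg)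
  let ψ : SchwartzMap ℂ ℂ := 𝓕⁻ φ
  have hψ : 𝓕 (ψ : ℂ → ℂ) = φ := by
    rw [← SchwartzMap.fourier_coe, FourierTransform.fourier_fourierInv_eq]
  have := VectorFourier.integral_fourierIntegral_smul_eq_flip (μ := (volume : Measure ℂ))
    (ν := (volume : Measure ℂ)) (L := innerₗ ℂ) (f := F) (g := (ψ : ℂ → ℂ))
    Real.continuous_fourierChar continuous_inner hF ψ.integrable
  have e1 : VectorFourier.fourierIntegral Real.fourierChar volume (innerₗ ℂ) F = 0 := h
  have e2 : VectorFourier.fourierIntegral Real.fourierChar volume (innerₗ ℂ).flip (ψ : ℂ → ℂ) = φ := by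
    rw [flip_innerₗ]; exact hψ
  rw [e1, e2] at this
  simp only [Pi.zero_apply, zero_smul, integral_zero] at this
  rw [this]
  refine integral_congr_ae (Filter.Eventually.of_forall fun z => ?_)
  have : φ z = g z := rfl
  simp [this, mul_comm]

/-- The form `w̄ z + w z̄` is twice the real inner product of `w` and `z`. -/
theorem expGrowth_realForm (w : ℂ) :
    ExpGrowth fun z => (starRingEnd ℂ) w * z + w * (starRingEnd ℂ) z :=
  (ExpGrowth.id.const_mul _).add (ExpGrowth.id.conj.const_mul _)

/-- Multiplication by `z` or `z̄` sends each `h_{a,b}` to a combination of its neighbours, so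
orthogonality to all `h_{a,b}` is stable under it. -/
theorem integral_mul_realForm_pow_eq_zero {f : ℂ → ℂ} (hf : MemLp f 2 gaussianMeasureC)
    (h : ∀ a b, ∫ z, f z * itoPoly a b z ∂gaussianMeasureC = 0) (w : ℂ) (p a b : ℕ) :
    ∫ z, f z * (((starRingEnd ℂ) w * z + w * (starRingEnd ℂ) z) ^ p * itoPoly a b z)
      ∂gaussianMeasureC = 0 := by
  induction p generalizing a b with
  | zero => simpa using h a b
  | succ p ih =>
    set ℓ := fun z => (starRingEnd ℂ) w * z + w * (starRingEnd ℂ) z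
    have I : ∀ a b, Integrable (fun z => f z * (ℓ z ^ p * itoPoly a b z)) gaussianMeasureC :=
      fun a b => hf.integrable_mul_expGrowth
        (((expGrowth_realForm w).pow p).mul (expGrowth_itoPoly a b))
    have e : ∀ z, f z * (ℓ z ^ (p + 1) * itoPoly a b z) =
        (starRingEnd ℂ w * (f z * (ℓ z ^ p * itoPoly (a + 1) b z)) +
          starRingEnd ℂ w * b * (f z * (ℓ z ^ p * itoPoly a (b - 1) z))) +
        (w * (f z * (ℓ z ^ p * itoPoly a (b + 1) z)) +
          w * a * (f z * (ℓ z ^ p * itoPoly (a - 1) b z))) := fun z => by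
      rw [itoPoly_succ_left, itoPoly_succ_right, pow_succ]
      simp only [ℓ]
      ring
    change ∫ z, f z * (ℓ z ^ (p + 1) * itoPoly a b z) ∂gaussianMeasureC = 0
    simp only [e]
    have K : ∀ c d a b a' b', Integrable (fun z => c * (f z * (ℓ z ^ p * itoPoly a b z)) +
        d * (f z * (ℓ z ^ p * itoPoly a' b' z))) gaussianMeasureC :=
      fun c d a b a' b' => ((I a b).const_mul c).add ((I a' b').const_mul d)
    rw [integral_add (K _ _ _ _ _ _) (K _ _ _ _ _ _),
      integral_add ((I _ _).const_mul _) ((I _ _).const_mul _),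
      integral_add ((I _ _).const_mul _) ((I _ _).const_mul _)]
    simp only [integral_const_mul]
    have ih' : ∀ a b, ∫ z, f z * (ℓ z ^ p * itoPoly a b z) ∂gaussianMeasureC = 0 := ih
    simp only [ih', mul_zero, add_zero]

theorem integral_mul_exp_eq_zero {X : Type*} [MeasurableSpace X] {μ : Measure X} {f g : X → ℂ}
    (hf : AEStronglyMeasurable f μ) (hg : AEStronglyMeasurable g μ)
    (hint : Integrable (fun x => ‖f x‖ * Real.exp ‖g x‖) μ)
    (h : ∀ n : ℕ, ∫ x, f x * g x ^ n ∂μ = 0) : ∫ x, f x * Complex.exp (g x) ∂μ = 0 := by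
  have hs : ∀ x : ℝ, HasSum (fun n : ℕ => x ^ n / n.factorial) (Real.exp x) := fun x => by
    rw [Real.exp_eq_exp_ℝ]; exact NormedSpace.expSeries_div_hasSum_exp x
  have hs' : ∀ x : ℂ, HasSum (fun n : ℕ => x ^ n / n.factorial) (Complex.exp x) := fun x => by
    rw [Complex.exp_eq_exp_ℂ]; exact NormedSpace.expSeries_div_hasSum_exp x
  have hsum : ∀ x, ∑' n : ℕ, ‖f x‖ * (‖g x‖ ^ n / n.factorial) = ‖f x‖ * Real.exp ‖g x‖ :=
    fun x => ((hs ‖g x‖).mul_left _).tsum_eq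
  have h1 : ∀ n : ℕ, AEStronglyMeasurable (fun x => f x * (g x ^ n / (n.factorial : ℂ))) μ :=
    fun n => hf.mul ((hg.pow n).div₀ aestronglyMeasurable_const)
  have h2 : ∀ (n : ℕ) x, ‖f x * (g x ^ n / (n.factorial : ℂ))‖ ≤
      ‖f x‖ * (‖g x‖ ^ n / n.factorial) := fun n x => by simp
  have h3 : Integrable (fun x => ∑' n : ℕ, ‖f x‖ * (‖g x‖ ^ n / n.factorial)) μ := by
    simpa only [hsum] using hint
  have h4 : ∀ x, HasSum (fun n : ℕ => f x * (g x ^ n / (n.factorial : ℂ)))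
      (f x * Complex.exp (g x)) := fun x => (hs' _).mul_left _
  have key := hasSum_integral_of_dominated_convergence _ h1
    (fun n => Filter.Eventually.of_forall (h2 n))
    (Filter.Eventually.of_forall fun x => ((hs _).mul_left _).summable) h3
    (Filter.Eventually.of_forall h4)
  have h0 : ∀ n : ℕ, ∫ x, f x * (g x ^ n / (n.factorial : ℂ)) ∂μ = 0 := fun n => by
    have e : ∀ x, f x * (g x ^ n / (n.factorial : ℂ)) =
        f x * g x ^ n * (n.factorial : ℂ)⁻¹ := fun x => by ring
    simp only [e]
    rw [integral_mul_const, h n, zero_mul]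
  simp only [h0] at key
  exact key.unique hasSum_zero

/-- The power series of a character can be integrated term by term against an `L²(μ)` function `f`,
because `|f| e^{a|z|}` is `μ`-integrable. -/
theorem integral_mul_character_eq_zero {f : ℂ → ℂ} (hf : MemLp f 2 gaussianMeasureC)
    (h : ∀ a b, ∫ z, f z * itoPoly a b z ∂gaussianMeasureC = 0) (w : ℂ) :
    ∫ z, f z * Complex.exp (Complex.I * ((starRingEnd ℂ) w * z + w * (starRingEnd ℂ) z))
      ∂gaussianMeasureC = 0 := by
  have hℓ := (expGrowth_realForm w).const_mul Complex.I
  have hexp : ExpGrowth fun z =>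
      ((Real.exp ‖Complex.I * ((starRingEnd ℂ) w * z + w * (starRingEnd ℂ) z)‖ : ℝ) : ℂ) := by
    refine ⟨Complex.continuous_ofReal.comp (Real.continuous_exp.comp hℓ.continuous.norm),
      1, 2 * ‖w‖, by positivity, by positivity, fun z => ?_⟩
    rw [Complex.norm_real, Real.norm_eq_abs, abs_of_pos (Real.exp_pos _), one_mul]
    refine Real.exp_le_exp.2 ?_
    rw [norm_mul, Complex.norm_I, one_mul]
    refine (norm_add_le _ _).trans ?_
    simp only [norm_mul, RCLike.norm_conj]
    linarith
  refine integral_mul_exp_eq_zero hf.1 hℓ.continuous.aestronglyMeasurable ?_ fun n => ?_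
  · refine (hf.integrable_mul_expGrowth hexp).norm.congr (Filter.Eventually.of_forall fun z => ?_)
    simp only [norm_mul, Complex.norm_real, Real.norm_eq_abs, abs_of_pos (Real.exp_pos _)]
  · have := integral_mul_realForm_pow_eq_zero hf h w n 0 0
    have e : ∀ z, f z * (Complex.I * ((starRingEnd ℂ) w * z + w * (starRingEnd ℂ) z)) ^ n =
        f z * (((starRingEnd ℂ) w * z + w * (starRingEnd ℂ) z) ^ n * itoPoly 0 0 z) *
          Complex.I ^ n := fun z => by
      rw [itoPoly_zero_left, mul_pow]; ring
    simp only [e]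
    rw [integral_mul_const, this, zero_mul]

theorem ae_eq_zero_of_integral_itoPoly_eq_zero {f : ℂ → ℂ} (hf : MemLp f 2 gaussianMeasureC)
    (h : ∀ a b, ∫ z, f z * itoPoly a b z ∂gaussianMeasureC = 0) :
    ∀ᵐ z ∂gaussianMeasureC, f z = 0 := by
  have hF : Integrable fun z => f z * gaussC 1 z := by
    rw [← integrable_gaussianMeasureC_iff]
    simpa using hf.integrable_mul_expGrowth (ExpGrowth.const 1)
  have hz : 𝓕 (fun z => f z * gaussC 1 z) = 0 := by
    funext w
    rw [Real.fourier_eq']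
    have := integral_mul_character_eq_zero hf h (-Real.pi * w)
    rw [integral_gaussianMeasureC] at this
    rw [Pi.zero_apply, ← this]
    refine integral_congr_ae (Filter.Eventually.of_forall fun z => ?_)
    have e : ((-2 * Real.pi * ⟪z, w⟫ : ℝ) : ℂ) * Complex.I =
        Complex.I * ((starRingEnd ℂ) (-Real.pi * w) * z + -Real.pi * w * (starRingEnd ℂ) z) := by
      rw [Complex.inner]
      push_cast
      rw [Complex.re_eq_add_conj]
      simp
      ring
    simp only [e, smul_eq_mul]
    ring
  rw [ae_gaussianMeasureC_iff]
  filter_upwards [ae_eq_zero_of_fourier_eq_zero hF hz] with z hz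
  have : gaussC 1 z ≠ 0 := by simp [gaussC, -Complex.ofReal_exp, Real.exp_ne_zero]
  exact (mul_eq_zero.1 hz).resolve_right this

end Completeness

/-! ### The poly-Bargmann spaces -/

theorem contDiff_wirtingerDz {f : ℂ → ℂ} (hf : ContDiff ℝ ∞ f) : ContDiff ℝ ∞ (wirtingerDz f) := by
  have h : ContDiff ℝ ∞ (fderiv ℝ f) := hf.fderiv_right (by simp)
  unfold wirtingerDz
  fun_prop

theorem contDiff_wirtingerDzbar {f : ℂ → ℂ} (hf : ContDiff ℝ ∞ f) :
    ContDiff ℝ ∞ (wirtingerDzbar f) := by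
  have h : ContDiff ℝ ∞ (fderiv ℝ f) := hf.fderiv_right (by simp)
  unfold wirtingerDzbar
  fun_prop

theorem HasCompactSupport.wirtingerDz {f : ℂ → ℂ} (hf : HasCompactSupport f) :
    HasCompactSupport (wirtingerDz f) :=
  (hf.fderiv ℝ).comp_left (g := fun L : ℂ →L[ℝ] ℂ => (1 / 2) * (L 1 - Complex.I * L Complex.I))
    (by simp)

theorem HasCompactSupport.wirtingerDzbar {f : ℂ → ℂ} (hf : HasCompactSupport f) :
    HasCompactSupport (wirtingerDzbar f) :=
  (hf.fderiv ℝ).comp_left (g := fun L : ℂ →L[ℝ] ℂ => (1 / 2) * (L 1 + Complex.I * L Complex.I))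
    (by simp)

theorem ContDiff.hasWirtingerAt {f : ℂ → ℂ} (hf : ContDiff ℝ ∞ f) (z : ℂ) :
    HasWirtingerAt f (wirtingerDz f z) (wirtingerDzbar f z) z :=
  (hf.differentiable (by simp) z).hasWirtingerAt

theorem ExpGrowth.of_test {f : ℂ → ℂ} (hf : ContDiff ℝ ∞ f) (hs : HasCompactSupport f) :
    ExpGrowth f := ExpGrowth.of_hasCompactSupport hf.continuous hs

theorem expGrowth_landauOp {φ : ℂ → ℂ} (hφ : ContDiff ℝ ∞ φ) (hs : HasCompactSupport φ) :
    ExpGrowth (landauOp φ) := by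
  have h1 := ExpGrowth.of_test (contDiff_wirtingerDzbar hφ) hs.wirtingerDzbar
  have h2 := ExpGrowth.of_test (contDiff_wirtingerDz (contDiff_wirtingerDzbar hφ))
    hs.wirtingerDzbar.wirtingerDz
  have := (h2.const_mul (-1)).add (ExpGrowth.id.conj.mul h1)
  have e : landauOp φ = fun z => -1 * wirtingerDz (wirtingerDzbar φ) z +
      (starRingEnd ℂ) z * wirtingerDzbar φ z := by
    funext z; rw [landauOp, neg_one_mul]
  rw [e]
  exact this

/-- The Itô–Hermite polynomial as an element of `L²(μ)`. -/
noncomputable def itoLp (m n : ℕ) : Lp ℂ 2 gaussianMeasureC := (expGrowth_itoPoly m n).memLp.toLp _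

theorem coeFn_itoLp (m n : ℕ) : itoLp m n =ᵐ[gaussianMeasureC] itoPoly m n := MemLp.coeFn_toLp _

theorem inner_itoLp_left (m n : ℕ) (u : Lp ℂ 2 gaussianMeasureC) :
    inner ℂ (itoLp m n) u = ∫ z, u z * itoPoly n m z ∂gaussianMeasureC := by
  rw [L2.inner_def]
  refine integral_congr_ae ?_
  filter_upwards [coeFn_itoLp m n] with z hz
  rw [hz, RCLike.inner_apply, conj_itoPoly]

theorem inner_itoLp_toLp (m n : ℕ) {g : ℂ → ℂ} (hg : MemLp g 2 gaussianMeasureC) :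
    inner ℂ (itoLp m n) (hg.toLp g) = ∫ z, g z * itoPoly n m z ∂gaussianMeasureC := by
  rw [inner_itoLp_left]
  refine integral_congr_ae ?_
  filter_upwards [hg.coeFn_toLp] with z hz
  rw [hz]

theorem inner_itoLp_itoLp (m n p q : ℕ) :
    inner ℂ (itoLp m n) (itoLp p q) =
      if p = m ∧ q = n then (p.factorial * q.factorial * Real.pi : ℂ) else 0 := by
  rw [itoLp, itoLp, ← itoLp, inner_itoLp_toLp, integral_gaussianMeasureC, ← itoPairing_one]
  rfl

theorem eq_zero_of_forall_inner_itoLp {u : Lp ℂ 2 gaussianMeasureC}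
    (h : ∀ a b, inner ℂ (itoLp a b) u = 0) : u = 0 := by
  rw [Lp.eq_zero_iff_ae_eq_zero]
  exact ae_eq_zero_of_integral_itoPoly_eq_zero (Lp.memLp u) fun a b => by
    rw [← inner_itoLp_left, h]

/-- The defining orthogonality, with the test functions' classes in `L²(μ)` written out as
integrals. -/
theorem mem_polyBargmann_iff {n : ℕ} {u : Lp ℂ 2 gaussianMeasureC} :
    u ∈ polyBargmann n ↔ ∀ φ : ℂ → ℂ, ContDiff ℝ ∞ φ → HasCompactSupport φ →
      ∫ z, (landauOp φ z - n * φ z) * (starRingEnd ℂ) (u z) ∂gaussianMeasureC = 0 := by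
  have key : ∀ (φ : ℂ → ℂ) (v : Lp ℂ 2 gaussianMeasureC),
      (v =ᵐ[gaussianMeasureC] fun z => landauOp φ z - (n : ℂ) * φ z) →
      inner ℂ u v = ∫ z, (landauOp φ z - n * φ z) * (starRingEnd ℂ) (u z) ∂gaussianMeasureC := by
    intro φ v hv
    rw [L2.inner_def]
    refine integral_congr_ae ?_
    filter_upwards [hv] with z hz
    rw [hz, RCLike.inner_apply]
  constructor
  · intro hu φ hφ hs
    have hL := (expGrowth_landauOp hφ hs).sub ((ExpGrowth.of_test hφ hs).const_mul n)
    rw [← key φ _ hL.memLp.coeFn_toLp]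
    exact (Submodule.mem_orthogonal' _ _).1 hu _
      (Submodule.subset_span ⟨φ, hφ, hs, hL.memLp.coeFn_toLp⟩)
  · intro h
    refine (Submodule.mem_orthogonal' _ _).2 fun v hv => ?_
    induction hv using Submodule.span_induction with
    | mem v hv =>
      obtain ⟨φ, hφ, hs, hv⟩ := hv
      rw [key φ v hv, h φ hφ hs]
    | zero => simp
    | add x y _ _ hx hy => rw [inner_add_right, hx, hy, add_zero]
    | smul c x _ hx => rw [inner_smul_right, hx, mul_zero]

/-- `h_{m,n}` satisfies `Δ h = n h` weakly: integrate by parts twice. -/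
theorem itoLp_mem_polyBargmann (m n : ℕ) : itoLp m n ∈ polyBargmann n := by
  rw [mem_polyBargmann_iff]
  intro φ hφ hs
  set ψ := wirtingerDzbar φ with hψdef
  have hψ : ContDiff ℝ ∞ ψ := contDiff_wirtingerDzbar hφ
  have hψs : HasCompactSupport ψ := hs.wirtingerDzbar
  have gφ := ExpGrowth.of_test hφ hs
  have gψ := ExpGrowth.of_test hψ hψs
  have gφz := ExpGrowth.of_test (contDiff_wirtingerDz hφ) hs.wirtingerDz
  have gψz := ExpGrowth.of_test (contDiff_wirtingerDz hψ) hψs.wirtingerDz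
  have gψb := ExpGrowth.of_test (contDiff_wirtingerDzbar hψ) hψs.wirtingerDzbar
  have G := expGrowth_itoPoly
  -- `i1` integrates `∂ (h_{n,m} ∂̄φ G)`, and `i2` integrates `∂̄ (h_{n-1,m} φ G)`
  have i1 := (integral_wirtinger_gaussC ((G n m).mul gψ)
    ((((G (n - 1) m).const_mul n).mul gψ).add ((G n m).mul gψz))
    ((((G n (m - 1)).const_mul m).mul gψ).add ((G n m).mul gψb))
    (fun z => (hasWirtingerAt_itoPoly n m z).mul (hψ.hasWirtingerAt z)) one_pos).1
  have i2 := (integral_wirtinger_gaussC ((G (n - 1) m).mul gφ)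
    ((((G (n - 1 - 1) m).const_mul (n - 1 : ℕ)).mul gφ).add ((G (n - 1) m).mul gφz))
    ((((G (n - 1) (m - 1)).const_mul m).mul gφ).add ((G (n - 1) m).mul gψ))
    (fun z => (hasWirtingerAt_itoPoly (n - 1) m z).mul (hφ.hasWirtingerAt z)) one_pos).2
  have j1 := ((((G (n - 1) m).const_mul n).mul gψ).add ((G n m).mul gψz)).sub
    ((ExpGrowth.id.conj.const_mul (1 : ℝ)).mul ((G n m).mul gψ)) |>.integrable_mul_gaussC one_pos
  have j2 := ((((G (n - 1) (m - 1)).const_mul m).mul gφ).add ((G (n - 1) m).mul gψ)).sub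
    ((ExpGrowth.id.const_mul (1 : ℝ)).mul ((G (n - 1) m).mul gφ)) |>.integrable_mul_gaussC one_pos
  have e : ∫ z, (landauOp φ z - n * φ z) * (starRingEnd ℂ) (itoLp m n z) ∂gaussianMeasureC =
      ∫ z, (landauOp φ z - n * φ z) * itoPoly n m z ∂gaussianMeasureC := by
    refine integral_congr_ae ?_
    filter_upwards [coeFn_itoLp m n] with z hz
    rw [hz, conj_itoPoly]
  rw [e, integral_gaussianMeasureC]
  have e2 : ∀ z, (landauOp φ z - n * φ z) * itoPoly n m z * gaussC 1 z =
      n * (((m * itoPoly (n - 1) (m - 1) z * φ z + itoPoly (n - 1) m z * ψ z) -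
        (1 : ℝ) * z * (itoPoly (n - 1) m z * φ z)) * gaussC 1 z) -
      ((n * itoPoly (n - 1) m z * ψ z + itoPoly n m z * wirtingerDz ψ z) -
        (1 : ℝ) * (starRingEnd ℂ) z * (itoPoly n m z * ψ z)) * gaussC 1 z := fun z => by
    rw [landauOp, ← hψdef]
    rcases n with _ | n
    · push_cast; ring
    · simp only [Nat.add_sub_cancel, itoPoly_succ_left n m]; push_cast; ring
  simp only [e2]
  rw [integral_sub (j2.const_mul _) j1, integral_const_mul, i1, i2]
  simp

/-- Dilated cut-offs converge under the integral. -/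
theorem tendsto_integral_mul_dilation {v θ B : ℂ → ℂ} (hv : MemLp v 2 gaussianMeasureC)
    (hθ : Continuous θ) (hθs : HasCompactSupport θ) (hB : ExpGrowth B) :
    Filter.Tendsto (fun N : ℕ => ∫ z, v z * (θ (((1 / ((N : ℝ) + 1) : ℝ) : ℂ) * z) * B z)
      ∂gaussianMeasureC) Filter.atTop (nhds (θ 0 * ∫ z, v z * B z ∂gaussianMeasureC)) := by
  obtain ⟨C, hC⟩ := hθs.exists_bound_of_continuous hθ
  rw [← integral_const_mul]
  refine tendsto_integral_of_dominated_convergence (fun z => C * ‖v z * B z‖) (fun N => ?_)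
    ((hv.integrable_mul_expGrowth hB).norm.const_mul C) (fun N => ?_) ?_
  · exact hv.1.mul ((hθ.comp (continuous_const.mul continuous_id)).mul
      hB.continuous).aestronglyMeasurable
  · refine Filter.Eventually.of_forall fun z => ?_
    simp only [norm_mul]
    calc ‖v z‖ * (‖θ (((1 / ((N : ℝ) + 1) : ℝ) : ℂ) * z)‖ * ‖B z‖) ≤ ‖v z‖ * (C * ‖B z‖) := by
          gcongr; exact hC _
      _ = _ := by ring
  · refine Filter.Eventually.of_forall fun z => ?_
    have h0 : Filter.Tendsto (fun N : ℕ => (((1 / ((N : ℝ) + 1) : ℝ) : ℂ) * z)) Filter.atTop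
        (nhds 0) := by
      have := (Complex.continuous_ofReal.tendsto 0).comp
        (tendsto_one_div_add_atTop_nhds_zero_nat (𝕜 := ℝ))
      simpa using this.mul_const z
    have := ((hθ.tendsto 0).comp h0).mul_const (v z * B z)
    refine this.congr fun N => ?_
    simp only [Function.comp_apply]
    ring

theorem integral_add_const_mul₃ {X : Type*} [MeasurableSpace X] {μ : Measure X}
    {f₁ f₂ f₃ f₄ : X → ℂ} (h₁ : Integrable f₁ μ) (h₂ : Integrable f₂ μ) (h₃ : Integrable f₃ μ)
    (h₄ : Integrable f₄ μ) (c₂ c₃ c₄ : ℂ) :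
    ∫ x, (f₁ x + c₂ * f₂ x + c₃ * f₃ x + c₄ * f₄ x) ∂μ =
      ∫ x, f₁ x ∂μ + c₂ * ∫ x, f₂ x ∂μ + c₃ * ∫ x, f₃ x ∂μ + c₄ * ∫ x, f₄ x ∂μ := by
  have i₂ : Integrable (fun x => f₁ x + c₂ * f₂ x) μ := h₁.add (h₂.const_mul c₂)
  have i₃ : Integrable (fun x => f₁ x + c₂ * f₂ x + c₃ * f₃ x) μ := i₂.add (h₃.const_mul c₃)
  rw [integral_add i₃ (h₄.const_mul c₄), integral_add i₂ (h₃.const_mul c₃),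
    integral_add h₁ (h₂.const_mul c₂)]
  simp only [integral_const_mul]

theorem contDiff_itoPoly (m n : ℕ) : ContDiff ℝ ∞ (itoPoly m n) := by
  induction m generalizing n with
  | zero => exact Complex.conjCLE.contDiff.pow n
  | succ m ih => exact (contDiff_id.mul (ih n)).sub (contDiff_const.mul (ih (n - 1)))

theorem HasWirtingerAt.comp_ofReal_mul {f : ℂ → ℂ} {a b z : ℂ} {c : ℝ}
    (h : HasWirtingerAt f a b (c * z)) :
    HasWirtingerAt (fun w => f (c * w)) (c * a) (c * b) z := by
  have h1 : HasFDerivAt (fun w : ℂ => (c : ℂ) * w) ((c : ℂ) • ContinuousLinearMap.id ℝ ℂ) z :=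
    (hasFDerivAt_id (𝕜 := ℝ) z).const_mul (c : ℂ)
  refine (HasFDerivAt.comp z h h1).congr_fderiv ?_
  ext
  simp
  ring

/-- The Landau operator on `χ(cz) h_{a,b}(z)`: apart from the expected term `χ(cz) b h_{a,b}`, every
term carries a factor `c`. -/
theorem landauOp_cutoff {χ : ℂ → ℂ} (hχ : ContDiff ℝ ∞ χ) (c : ℝ) (a b : ℕ) (z : ℂ) :
    landauOp (fun w => χ (c * w) * itoPoly a b w) z =
      χ (c * z) * (b * itoPoly a b z) +
      c * (wirtingerDzbar χ (c * z) *
        ((starRingEnd ℂ) z * itoPoly a b z - a * itoPoly (a - 1) b z)) +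
      c * (wirtingerDz χ (c * z) * (-b * itoPoly a (b - 1) z)) +
      c ^ 2 * (wirtingerDz (wirtingerDzbar χ) (c * z) * (-itoPoly a b z)) := by
  have h1 : wirtingerDzbar (fun w => χ (c * w) * itoPoly a b w) = fun w =>
      c * wirtingerDzbar χ (c * w) * itoPoly a b w + χ (c * w) * (b * itoPoly a (b - 1) w) := by
    funext w
    exact ((hχ.hasWirtingerAt (c * w)).comp_ofReal_mul.mul
      (hasWirtingerAt_itoPoly a b w)).wirtingerDzbar_eq
  have h2 := (((((contDiff_wirtingerDzbar hχ).hasWirtingerAt (c * z)).comp_ofReal_mul.const_mul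
      (c : ℂ)).mul (hasWirtingerAt_itoPoly a b z)).add
    ((hχ.hasWirtingerAt (c * z)).comp_ofReal_mul.mul
      ((hasWirtingerAt_itoPoly a (b - 1) z).const_mul (b : ℂ)))).wirtingerDz_eq
  rw [landauOp, h1, h2]
  rcases b with _ | b
  · simp; ring
  · simp only [Nat.add_sub_cancel]
    rw [itoPoly_succ_right a b]
    push_cast
    ring

/-- Distinct eigenvalues give orthogonality. The polynomial `h_{a,b}` is not a test function, so it
is cut off at radius `N → ∞`. -/
theorem inner_itoLp_of_mem_polyBargmann {n : ℕ} {u : Lp ℂ 2 gaussianMeasureC}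
    (hu : u ∈ polyBargmann n) {a b : ℕ} (hb : b ≠ n) : inner ℂ (itoLp a b) u = 0 := by
  rw [mem_polyBargmann_iff] at hu
  let χ₀ : ContDiffBump (0 : ℂ) := ⟨1, 2, by norm_num, by norm_num⟩
  set χ : ℂ → ℂ := fun z => (χ₀ z : ℂ) with hχdef
  have hχ : ContDiff ℝ ∞ χ := Complex.ofRealCLM.contDiff.comp χ₀.contDiff
  have hs : HasCompactSupport χ := χ₀.hasCompactSupport.comp_left (g := Complex.ofReal) rfl
  have hχ0 : χ 0 = 1 := by
    simp only [hχdef]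
    rw [χ₀.one_of_mem_closedBall (by simp [χ₀])]; rfl
  have hv : MemLp (fun z => (starRingEnd ℂ) (u z)) 2 gaussianMeasureC := (Lp.memLp u).star
  set v : ℂ → ℂ := fun z => (starRingEnd ℂ) (u z)
  have G := expGrowth_itoPoly
  have gB : ExpGrowth fun z => (starRingEnd ℂ) z * itoPoly a b z - a * itoPoly (a - 1) b z :=
    (ExpGrowth.id.conj.mul (G a b)).sub ((G (a - 1) b).const_mul a)
  have gC : ExpGrowth fun z => -(b : ℂ) * itoPoly a (b - 1) z := (G a (b - 1)).const_mul _
  have gD : ExpGrowth fun z => -itoPoly a b z := by simpa using (G a b).const_mul (-1)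
  have tA := tendsto_integral_mul_dilation hv hχ.continuous hs ((G a b).const_mul ((b : ℂ) - n))
  have tB := tendsto_integral_mul_dilation hv (contDiff_wirtingerDzbar hχ).continuous
    hs.wirtingerDzbar gB
  have tC := tendsto_integral_mul_dilation hv (contDiff_wirtingerDz hχ).continuous
    hs.wirtingerDz gC
  have tD := tendsto_integral_mul_dilation hv
    (contDiff_wirtingerDz (contDiff_wirtingerDzbar hχ)).continuous hs.wirtingerDzbar.wirtingerDz gD
  have tc : Filter.Tendsto (fun N : ℕ => ((1 / ((N : ℝ) + 1) : ℝ) : ℂ)) Filter.atTop (nhds 0) := by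
    simpa [Function.comp_def] using (Complex.continuous_ofReal.tendsto 0).comp
      (tendsto_one_div_add_atTop_nhds_zero_nat (𝕜 := ℝ))
  have t := ((tA.add (tc.mul tB)).add (tc.mul tC)).add ((tc.pow 2).mul tD)
  have iθ : ∀ {θ B : ℂ → ℂ} (_ : Continuous θ) (_ : HasCompactSupport θ) (_ : ExpGrowth B) (c : ℝ),
      Integrable (fun z => v z * (θ (c * z) * B z)) gaussianMeasureC := by
    intro θ B hθ hθs hB c
    obtain ⟨C, hC⟩ := hθs.exists_bound_of_continuous hθ
    exact hv.integrable_mul_expGrowth ((ExpGrowth.of_bounded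
      (hθ.comp (continuous_const.mul continuous_id)) (fun z => hC _)).mul hB)
  have t' : Filter.Tendsto (fun _ : ℕ => (0 : ℂ)) Filter.atTop _ := t.congr fun N => by
    set c : ℝ := 1 / ((N : ℝ) + 1) with hc
    have hc0 : (c : ℂ) ≠ 0 := by
      rw [hc]; exact_mod_cast (by positivity : (0 : ℝ) < 1 / ((N : ℝ) + 1)).ne'
    have hsc : HasCompactSupport fun w => χ (c * w) * itoPoly a b w :=
      (hs.comp_homeomorph (Homeomorph.mulLeft₀ (c : ℂ) hc0)).mul_right
    have hcd : ContDiff ℝ ∞ fun w => χ (c * w) * itoPoly a b w :=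
      (hχ.comp (contDiff_const.mul contDiff_id)).mul (contDiff_itoPoly a b)
    have h := hu _ hcd hsc
    have iA := iθ hχ.continuous hs ((G a b).const_mul ((b : ℂ) - n)) c
    have iB := iθ (contDiff_wirtingerDzbar hχ).continuous hs.wirtingerDzbar gB c
    have iC := iθ (contDiff_wirtingerDz hχ).continuous hs.wirtingerDz gC c
    have iD := iθ (contDiff_wirtingerDz (contDiff_wirtingerDzbar hχ)).continuous
      hs.wirtingerDzbar.wirtingerDz gD c
    rw [← h, ← integral_add_const_mul₃ iA iB iC iD]
    refine integral_congr_ae (Filter.Eventually.of_forall fun z => ?_)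
    change _ = _ * v z
    simp only [landauOp_cutoff hχ]
    ring
  have hlim := tendsto_nhds_unique tendsto_const_nhds t'
  have hI : ∫ z, v z * ((b - n) * itoPoly a b z) ∂gaussianMeasureC =
      (b - n) * inner ℂ u (itoLp a b) := by
    rw [L2.inner_def, ← integral_const_mul]
    refine integral_congr_ae ?_
    filter_upwards [coeFn_itoLp a b] with z hz
    rw [hz, RCLike.inner_apply]
    change v z * _ = _ * (_ * v z)
    ring
  rw [hI, hχ0] at hlim
  have hbn : (b : ℂ) - n ≠ 0 := sub_ne_zero.2 (by exact_mod_cast hb)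
  have : inner ℂ u (itoLp a b) = 0 := by simpa [hbn] using hlim.symm
  exact inner_eq_zero_symm.1 this

/-- The `h_{m,n}` with `n` fixed span `A²_n`, so that the projection onto `A²_n` is determined by
the coefficients along them. -/
theorem polyBargmannProj_eq_of_inner_eq {n : ℕ} {u v : Lp ℂ 2 gaussianMeasureC}
    (hv : v ∈ polyBargmann n) (h : ∀ m, inner ℂ (itoLp m n) u = inner ℂ (itoLp m n) v) :
    polyBargmannProj n u = v := by
  have : (polyBargmann n).HasOrthogonalProjection := by
    unfold polyBargmann; infer_instance
  have hP : (polyBargmann n).starProjection u = v := by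
    refine Submodule.eq_starProjection_of_mem_of_inner_eq_zero hv fun w hw => ?_
    let S : Submodule ℂ (Lp ℂ 2 gaussianMeasureC) :=
      Submodule.span ℂ (Set.range fun m => itoLp m n)
    let K := S.topologicalClosure
    have : CompleteSpace K := S.isClosed_topologicalClosure.completeSpace_coe
    have hmemK : ∀ m, itoLp m n ∈ K := fun m =>
      S.le_topologicalClosure (Submodule.subset_span ⟨m, rfl⟩)
    -- a vector orthogonal to the generators is orthogonal to their closed span
    have horth : ∀ x : Lp ℂ 2 gaussianMeasureC, (∀ m, inner ℂ (itoLp m n) x = 0) →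
        ∀ y ∈ K, inner ℂ x y = 0 := by
      intro x hx y hy
      have hle : K ≤ (Submodule.span ℂ {x})ᗮ := by
        refine Submodule.topologicalClosure_minimal _ ?_ (Submodule.isClosed_orthogonal _)
        refine Submodule.span_le.2 ?_
        rintro _ ⟨m, rfl⟩
        exact Submodule.mem_orthogonal_singleton_iff_inner_left.2 (hx m)
      exact Submodule.mem_orthogonal_singleton_iff_inner_right.1 (hle hy)
    -- by completeness, `w - P_K w` vanishes: it is orthogonal to every `h_{a,b}`
    have hwK : w ∈ K := by
      have h0 : w - K.starProjection w = 0 := by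
        refine eq_zero_of_forall_inner_itoLp fun a b => ?_
        by_cases hb : b = n
        · subst hb
          exact inner_eq_zero_symm.1 (K.starProjection_inner_eq_zero w _ (hmemK a))
        · rw [inner_sub_right, inner_itoLp_of_mem_polyBargmann hw hb, zero_sub, neg_eq_zero]
          refine horth _ (fun m => ?_) _ (K.starProjection_apply_mem w)
          rw [inner_itoLp_itoLp, if_neg fun hh => hb hh.2]
      rw [sub_eq_zero.1 h0]
      exact K.starProjection_apply_mem w
    exact horth _ (fun m => by rw [inner_sub_right, h m, sub_self]) w hwK
  exact hP

/-! ### Boundedness and antisymmetry of the Cauchy transform -/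

theorem integrable_cauchyKernel_near_zero :
    Integrable (Set.indicator (Metric.ball (0 : ℂ) 1) fun w => ‖w‖⁻¹) := by
  rw [integrable_indicator_iff Metric.isOpen_ball.measurableSet]
  refine integrableOn_ball_of_norm_le_rpow (C := 1) (α := 1) ?_ ?_ ?_ ?_
  · simp
  · norm_num
  · exact Filter.Eventually.of_forall fun w => by simp [Real.rpow_neg_one]
  · exact (measurable_norm.inv).aestronglyMeasurable

theorem ExpGrowth.norm_mul_gaussC_bounded {f : ℂ → ℂ} (hf : ExpGrowth f) :
    ∃ C : ℝ, 0 ≤ C ∧ ∀ z, ‖f z * gaussC 1 z‖ ≤ C := by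
  obtain ⟨C, hC, h⟩ := hf.norm_mul_gaussC_le one_pos
  refine ⟨C, hC, fun z => (h z).trans (mul_le_of_le_one_right hC ?_)⟩
  exact Real.exp_le_one_iff.2 (by simp only [neg_nonpos]; positivity)

/-- The singularity `1/|z-ξ|` is locally integrable uniformly in `z`, and away from it the kernel is
at most `1`. -/
theorem ExpGrowth.cauchy_bound {f : ℂ → ℂ} (hf : ExpGrowth f) :
    ∃ M : ℝ, ∀ z, Integrable (fun ξ => f ξ / (z - ξ)) gaussianMeasureC ∧
      Integrable (fun ξ => ‖f ξ * gaussC 1 ξ‖ * ‖z - ξ‖⁻¹) ∧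
      ∫ ξ, ‖f ξ / (z - ξ)‖ ∂gaussianMeasureC ≤ M := by
  obtain ⟨C, hC, hb⟩ := hf.norm_mul_gaussC_bounded
  have hFi := hf.integrable_mul_gaussC one_pos
  set k : ℂ → ℝ := Set.indicator (Metric.ball (0 : ℂ) 1) fun w => ‖w‖⁻¹ with hk
  have hki : Integrable k := integrable_cauchyKernel_near_zero
  refine ⟨(C * ∫ w, k w) + ∫ ξ, ‖f ξ * gaussC 1 ξ‖, fun z => ?_⟩
  have hdom : ∀ ξ, ‖f ξ * gaussC 1 ξ‖ * ‖z - ξ‖⁻¹ ≤ C * k (z - ξ) + ‖f ξ * gaussC 1 ξ‖ := by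
    intro ξ
    by_cases hξ : z - ξ ∈ Metric.ball (0 : ℂ) 1
    · rw [hk, Set.indicator_of_mem hξ]
      have := mul_le_mul_of_nonneg_right (hb ξ) (inv_nonneg.2 (norm_nonneg (z - ξ)))
      linarith [norm_nonneg (f ξ * gaussC 1 ξ)]
    · rw [hk, Set.indicator_of_notMem hξ, mul_zero, zero_add]
      refine mul_le_of_le_one_right (norm_nonneg _) (inv_le_one_of_one_le₀ ?_)
      simpa using hξ
  have hi : Integrable fun ξ => C * k (z - ξ) + ‖f ξ * gaussC 1 ξ‖ :=
    ((hki.comp_sub_left z).const_mul C).add hFi.norm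
  have hm : Measurable fun ξ => f ξ / (z - ξ) :=
    hf.continuous.measurable.div (measurable_const.sub measurable_id)
  have hi2 : Integrable (fun ξ => ‖f ξ * gaussC 1 ξ‖ * ‖z - ξ‖⁻¹) := by
    refine hi.mono' ?_ (Filter.Eventually.of_forall fun ξ => ?_)
    · exact ((hf.continuous.mul (continuous_gaussC 1)).measurable.norm.mul
        (measurable_const.sub measurable_id).norm.inv).aestronglyMeasurable
    · rw [Real.norm_of_nonneg (by positivity)]
      exact hdom ξ
  have hn : ∀ ξ, ‖f ξ / (z - ξ) * gaussC 1 ξ‖ = ‖f ξ * gaussC 1 ξ‖ * ‖z - ξ‖⁻¹ := fun ξ => by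
    simp only [norm_mul, norm_div]; ring
  refine ⟨(integrable_gaussianMeasureC_iff _).2 ?_, hi2, ?_⟩
  · exact hi2.mono' (hm.mul (continuous_gaussC 1).measurable).aestronglyMeasurable
      (Filter.Eventually.of_forall fun ξ => (hn ξ).le)
  · have e : ∫ ξ, ‖f ξ / (z - ξ)‖ ∂gaussianMeasureC = ∫ ξ, ‖f ξ * gaussC 1 ξ‖ * ‖z - ξ‖⁻¹ := by
      rw [gaussianMeasureC, integral_withDensity_eq_integral_toReal_smul measurable_gaussDensity
        (Filter.Eventually.of_forall fun _ => ENNReal.ofReal_lt_top)]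
      refine integral_congr_ae (Filter.Eventually.of_forall fun ξ => ?_)
      simp only [ENNReal.toReal_ofReal (Real.exp_pos _).le, norm_mul, norm_div, norm_gaussC,
        one_mul, smul_eq_mul]
      ring
    rw [e]
    have hk0 : ∫ ξ, k (z - ξ) = ∫ w, k w := integral_sub_left_eq_self k volume z
    calc _ ≤ ∫ ξ, (C * k (z - ξ) + ‖f ξ * gaussC 1 ξ‖) := integral_mono hi2 hi hdom
      _ = _ := by
        rw [integral_add ((hki.comp_sub_left z).const_mul C) hFi.norm, integral_const_mul,
          hk0]

theorem ExpGrowth.measurable_uncurry_cauchy {f : ℂ → ℂ} (hf : ExpGrowth f) :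
    Measurable fun p : ℂ × ℂ => f p.2 / (p.1 - p.2) :=
  (hf.continuous.measurable.comp measurable_snd).div (measurable_fst.sub measurable_snd)

theorem ExpGrowth.memLp_cauchyTransform {f : ℂ → ℂ} (hf : ExpGrowth f) :
    MemLp (cauchyTransform f) 2 gaussianMeasureC := by
  obtain ⟨M, hM⟩ := hf.cauchy_bound
  have hm : StronglyMeasurable fun z => ∫ ξ, f ξ / (z - ξ) ∂gaussianMeasureC :=
    StronglyMeasurable.integral_prod_right (f := fun z ξ => f ξ / (z - ξ))
      hf.measurable_uncurry_cauchy.stronglyMeasurable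
  refine MemLp.of_bound (hm.const_mul _).aestronglyMeasurable (‖(1 / (Real.pi : ℂ))‖ * M)
    (Filter.Eventually.of_forall fun z => ?_)
  rw [cauchyTransform, norm_mul]
  gcongr
  exact (norm_integral_le_integral_norm _).trans (hM z).2.2

/-- The kernel `1/(z-ξ)` is antisymmetric, hence so is the Cauchy transform for the bilinear pairing
of `L²(μ)`. -/
theorem integral_cauchyTransform_mul {f g : ℂ → ℂ} (hf : ExpGrowth f) (hg : ExpGrowth g) :
    ∫ z, cauchyTransform f z * g z ∂gaussianMeasureC =
      -∫ z, f z * cauchyTransform g z ∂gaussianMeasureC := by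
  obtain ⟨M, hM⟩ := hf.cauchy_bound
  have hgm : Measurable fun p : ℂ × ℂ => g p.1 := (hg.continuous.comp continuous_fst).measurable
  have hmeas : Measurable fun p : ℂ × ℂ => f p.2 / (p.1 - p.2) * g p.1 :=
    hf.measurable_uncurry_cauchy.mul hgm
  have hint : Integrable (fun p : ℂ × ℂ => f p.2 / (p.1 - p.2) * g p.1)
      (gaussianMeasureC.prod gaussianMeasureC) := by
    rw [integrable_prod_iff hmeas.aestronglyMeasurable]
    have hsec : ∀ z, Integrable (fun ξ => f ξ / (z - ξ) * g z) gaussianMeasureC := fun z =>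
      (hM z).1.mul_const (g z)
    refine ⟨Filter.Eventually.of_forall hsec, ?_⟩
    have hmn : StronglyMeasurable fun z => ∫ ξ, ‖f ξ / (z - ξ) * g z‖ ∂gaussianMeasureC :=
      StronglyMeasurable.integral_prod_right (f := fun z ξ => ‖f ξ / (z - ξ) * g z‖)
        hmeas.norm.stronglyMeasurable
    refine (hg.integrable.norm.const_mul M).mono' hmn.aestronglyMeasurable
      (Filter.Eventually.of_forall fun z => ?_)
    rw [Real.norm_of_nonneg (integral_nonneg fun _ => norm_nonneg _)]
    simp only [norm_mul]
    rw [integral_mul_const]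
    exact mul_le_mul_of_nonneg_right (hM z).2.2 (norm_nonneg _)
  have e1 : ∀ z, cauchyTransform f z * g z =
      (1 / (Real.pi : ℂ)) * ∫ ξ, f ξ / (z - ξ) * g z ∂gaussianMeasureC := fun z => by
    rw [integral_mul_const, cauchyTransform, mul_assoc]
  have e2 : ∀ ξ, f ξ * cauchyTransform g ξ =
      -((1 / (Real.pi : ℂ)) * ∫ z, f ξ / (z - ξ) * g z ∂gaussianMeasureC) := fun ξ => by
    have : ∀ z, f ξ / (z - ξ) * g z = -f ξ * (g z / (ξ - z)) := fun z => by
      rw [← neg_sub ξ z, div_neg]; ring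
    simp only [this]
    rw [integral_const_mul, cauchyTransform]
    ring
  simp only [e1, e2]
  rw [integral_const_mul, integral_neg, integral_const_mul, neg_neg,
    integral_integral_swap (f := fun z ξ => f ξ / (z - ξ) * g z) hint]

/-! ### The Cauchy–Pompeiu formula for Itô–Hermite functions -/

theorem integrable_inv_one_add_normSq_sq :
    Integrable fun w : ℂ => ((‖w‖ ^ 2 + 1) ^ 2)⁻¹ := by
  have h := integrable_rpow_neg_one_add_norm_sq (E := ℂ) (μ := volume) (r := 4)
    (by norm_num)
  refine h.congr (Filter.Eventually.of_forall fun w => ?_)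
  have : (-4 / 2 : ℝ) = -((2 : ℕ) : ℝ) := by norm_num
  simp only
  rw [this, Real.rpow_neg (by positivity), Real.rpow_natCast, add_comm]

theorem integral_inv_one_add_normSq_sq :
    ∫ w : ℂ, ((‖w‖ ^ 2 + 1) ^ 2)⁻¹ = Real.pi := by
  have hd : ∀ y : ℝ, HasDerivAt (fun y : ℝ => -(2 * (y ^ 2 + 1))⁻¹)
      (y * ((y ^ 2 + 1) ^ 2)⁻¹) y := fun y => by
    have h1 : HasDerivAt (fun y : ℝ => 2 * (y ^ 2 + 1)) (2 * (2 * y)) y := by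
      simpa using (((hasDerivAt_pow 2 y).add_const 1).const_mul 2)
    have h2 : (2 * (y ^ 2 + 1)) ≠ 0 := by positivity
    refine (h1.inv h2).neg.congr_deriv ?_
    field_simp
  have hlim : Filter.Tendsto (fun y : ℝ => -(2 * (y ^ 2 + 1))⁻¹) Filter.atTop (nhds 0) := by
    have h1 : Filter.Tendsto (fun y : ℝ => 2 * (y ^ 2 + 1)) Filter.atTop Filter.atTop :=
      (Filter.tendsto_atTop_add_const_right _ _
        (Filter.tendsto_pow_atTop two_ne_zero)).const_mul_atTop two_pos
    simpa using h1.inv_tendsto_atTop.neg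
  have hI : ∫ y in Set.Ioi (0 : ℝ), y * ((y ^ 2 + 1) ^ 2)⁻¹ = 1 / 2 := by
    rw [integral_Ioi_of_hasDerivAt_of_nonneg' (fun y _ => hd y)
      (fun y hy => by have : (0 : ℝ) < y := hy; positivity) hlim]
    norm_num
  have h := integral_fun_norm_addHaar (volume : Measure ℂ) (fun y : ℝ => ((y ^ 2 + 1) ^ 2)⁻¹)
  rw [h]
  simp only [Complex.finrank_real_complex, smul_eq_mul, Nat.add_one_sub_one, pow_one, hI]
  simp [Measure.real]
  ring

theorem hasWirtingerAt_inv_normSq_add {ε : ℝ} (hε : 0 < ε) (z ξ : ℂ) :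
    HasWirtingerAt (fun w => (((‖z - w‖ ^ 2 + ε)⁻¹ : ℝ) : ℂ))
      ((starRingEnd ℂ) (z - ξ) * (((‖z - ξ‖ ^ 2 + ε)⁻¹ : ℝ) : ℂ) ^ 2)
      ((z - ξ) * (((‖z - ξ‖ ^ 2 + ε)⁻¹ : ℝ) : ℂ) ^ 2) ξ := by
  have h1 : HasWirtingerAt (fun w => ((‖z - w‖ ^ 2 : ℝ) : ℂ)) (-(starRingEnd ℂ) (z - ξ))
      (-(z - ξ)) ξ := by
    have := ((HasWirtingerAt.const z ξ).sub (HasWirtingerAt.id ξ)).mul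
      ((HasWirtingerAt.const ((starRingEnd ℂ) z) ξ).sub (HasWirtingerAt.conj ξ))
    have e : (fun w => (z - w) * ((starRingEnd ℂ) z - (starRingEnd ℂ) w)) =
        fun w => ((‖z - w‖ ^ 2 : ℝ) : ℂ) := by
      funext w
      rw [← map_sub, Complex.mul_conj, Complex.normSq_eq_norm_sq]
    rw [e] at this
    exact this.congr_deriv (by simp) (by simp)
  have hpos : ‖z - ξ‖ ^ 2 + ε ≠ 0 := by positivity
  have h2 : HasDerivAt (fun t : ℝ => (t + ε)⁻¹) (-((‖z - ξ‖ ^ 2 + ε)⁻¹) ^ 2) (‖z - ξ‖ ^ 2) := by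
    have := ((hasDerivAt_id (‖z - ξ‖ ^ 2)).add_const ε).inv hpos
    refine this.congr_deriv ?_
    simp only [id]
    field_simp
  exact (h1.ofReal_comp h2).congr_deriv (by push_cast; ring) (by push_cast; ring)

/-- Integration by parts against the mollified kernel `w̄ / (|w|² + ε)` of `1 / w`, whose `∂̄`
is `ε / (|w|² + ε)²`. -/
theorem integral_itoPoly_mollified {ε : ℝ} (hε : 0 < ε) (j k : ℕ) (z : ℂ) :
    ∫ ξ, itoPoly (j + 1) k ξ * gaussC 1 ξ *
        ((starRingEnd ℂ) (z - ξ) * (((‖z - ξ‖ ^ 2 + ε)⁻¹ : ℝ) : ℂ)) =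
      -∫ ξ, itoPoly j k ξ * gaussC 1 ξ * (ε * (((‖z - ξ‖ ^ 2 + ε)⁻¹ : ℝ) : ℂ) ^ 2) := by
  have G := expGrowth_itoPoly
  have gw : ExpGrowth fun ξ => z - ξ := (ExpGrowth.const z).sub ExpGrowth.id
  have gr : ExpGrowth fun ξ => (((‖z - ξ‖ ^ 2 + ε)⁻¹ : ℝ) : ℂ) := by
    refine ExpGrowth.of_bounded (C := ε⁻¹) (continuous_iff_continuousAt.2 fun ξ =>
      (hasWirtingerAt_inv_normSq_add hε z ξ).continuousAt) fun ξ => ?_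
    rw [Complex.norm_real, Real.norm_of_nonneg (by positivity)]
    gcongr
    linarith [sq_nonneg ‖z - ξ‖]
  have hK : ∀ ξ, HasWirtingerAt
      (fun w => (starRingEnd ℂ) (z - w) * (((‖z - w‖ ^ 2 + ε)⁻¹ : ℝ) : ℂ))
      ((starRingEnd ℂ) (z - ξ) ^ 2 * (((‖z - ξ‖ ^ 2 + ε)⁻¹ : ℝ) : ℂ) ^ 2)
      (-ε * (((‖z - ξ‖ ^ 2 + ε)⁻¹ : ℝ) : ℂ) ^ 2) ξ := fun ξ => by
    have h0 : HasWirtingerAt (fun w => (starRingEnd ℂ) (z - w)) 0 (-1) ξ := by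
      simp only [map_sub]
      exact ((HasWirtingerAt.const _ ξ).sub (HasWirtingerAt.conj ξ)).congr_deriv
        (by simp) (by simp)
    refine (h0.mul (hasWirtingerAt_inv_normSq_add hε z ξ)).congr_deriv (by ring) ?_
    have h1 : ((‖z - ξ‖ ^ 2 : ℝ) : ℂ) = (z - ξ) * (starRingEnd ℂ) (z - ξ) := by
      rw [Complex.mul_conj, Complex.normSq_eq_norm_sq]
    have h2 : (((‖z - ξ‖ ^ 2 : ℝ) : ℂ) + ε) * (((‖z - ξ‖ ^ 2 + ε)⁻¹ : ℝ) : ℂ) = 1 := by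
      rw [← Complex.ofReal_add, ← Complex.ofReal_mul, mul_inv_cancel₀ (by positivity)]
      simp
    rw [h1] at h2
    linear_combination (((‖z - ξ‖ ^ 2 + ε)⁻¹ : ℝ) : ℂ) * h2
  have gK := gw.conj.mul gr
  have gKb := (gr.pow 2).const_mul (-ε : ℂ)
  have gKa := (gw.conj.pow 2).mul (gr.pow 2)
  have h := (integral_wirtinger_gaussC ((G j k).mul gK)
    ((((G (j - 1) k).const_mul j).mul gK).add ((G j k).mul gKa))
    ((((G j (k - 1)).const_mul k).mul gK).add ((G j k).mul gKb))
    (fun ξ => (hasWirtingerAt_itoPoly j k ξ).mul (hK ξ)) one_pos).2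
  have i1 := ((G (j + 1) k).mul gK).integrable_mul_gaussC one_pos
  have i2 := ((G j k).mul ((gr.pow 2).const_mul (ε : ℂ))).integrable_mul_gaussC one_pos
  have e : ∀ ξ, ((k * itoPoly j (k - 1) ξ *
        ((starRingEnd ℂ) (z - ξ) * (((‖z - ξ‖ ^ 2 + ε)⁻¹ : ℝ) : ℂ)) +
      itoPoly j k ξ * (-ε * (((‖z - ξ‖ ^ 2 + ε)⁻¹ : ℝ) : ℂ) ^ 2)) - (1 : ℝ) * ξ *
        (itoPoly j k ξ * ((starRingEnd ℂ) (z - ξ) * (((‖z - ξ‖ ^ 2 + ε)⁻¹ : ℝ) : ℂ)))) *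
          gaussC 1 ξ =
      -1 * (itoPoly (j + 1) k ξ *
        ((starRingEnd ℂ) (z - ξ) * (((‖z - ξ‖ ^ 2 + ε)⁻¹ : ℝ) : ℂ)) * gaussC 1 ξ) -
      itoPoly j k ξ * (ε * (((‖z - ξ‖ ^ 2 + ε)⁻¹ : ℝ) : ℂ) ^ 2) * gaussC 1 ξ := fun ξ => by
    rw [itoPoly_succ_left]
    simp only [Complex.ofReal_one]
    ring
  simp only [e] at h
  rw [integral_sub (i1.const_mul _) i2, integral_const_mul] at h
  simp only [mul_right_comm _ (gaussC 1 _)]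
  linear_combination -h

/-- The kernels `ε / (|w|² + ε)²` with `ε = δ²` are `π` times an approximate identity. -/
theorem tendsto_integral_poisson {F : ℂ → ℂ} (hF : Continuous F) {C : ℝ} (hC : ∀ z, ‖F z‖ ≤ C)
    (z : ℂ) :
    Filter.Tendsto (fun N : ℕ => ∫ ξ, F ξ * ((((1 / ((N : ℝ) + 1)) ^ 2 : ℝ) : ℂ) *
      (((‖z - ξ‖ ^ 2 + (1 / ((N : ℝ) + 1)) ^ 2)⁻¹ : ℝ) : ℂ) ^ 2)) Filter.atTop
      (nhds (Real.pi * F z)) := by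
  have hchange : ∀ N : ℕ, ∫ ξ, F ξ * ((((1 / ((N : ℝ) + 1)) ^ 2 : ℝ) : ℂ) *
      (((‖z - ξ‖ ^ 2 + (1 / ((N : ℝ) + 1)) ^ 2)⁻¹ : ℝ) : ℂ) ^ 2) =
      ∫ w, F (z - (1 / ((N : ℝ) + 1)) • w) * ((((‖w‖ ^ 2 + 1) ^ 2)⁻¹ : ℝ) : ℂ) := fun N => by
    set δ : ℝ := 1 / ((N : ℝ) + 1)
    have hδ : 0 < δ := by positivity
    have h1 := integral_sub_left_eq_self (μ := (volume : Measure ℂ))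
      (fun ξ => F ξ * (((δ ^ 2 : ℝ) : ℂ) * (((‖z - ξ‖ ^ 2 + δ ^ 2)⁻¹ : ℝ) : ℂ) ^ 2)) z
    have h2 := Measure.integral_comp_smul (volume : Measure ℂ)
      (fun ξ => F (z - ξ) * (((δ ^ 2 : ℝ) : ℂ) * (((‖ξ‖ ^ 2 + δ ^ 2)⁻¹ : ℝ) : ℂ) ^ 2)) δ
    simp only [sub_sub_cancel] at h1
    rw [Complex.finrank_real_complex, abs_of_pos (by positivity), h1] at h2
    have h3 := congrArg (fun x : ℂ => ((δ ^ 2 : ℝ) : ℂ) * x) h2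
    simp only [Complex.real_smul] at h3
    rw [← mul_assoc, ← Complex.ofReal_mul, mul_inv_cancel₀ (by positivity), Complex.ofReal_one,
      one_mul, ← integral_const_mul] at h3
    rw [← h3]
    refine integral_congr_ae (Filter.Eventually.of_forall fun w => ?_)
    have e : δ ^ 2 * (δ ^ 2 * ((‖(δ : ℂ) * w‖ ^ 2 + δ ^ 2)⁻¹) ^ 2) = ((‖w‖ ^ 2 + 1) ^ 2)⁻¹ := by
      rw [norm_mul, Complex.norm_real, Real.norm_of_nonneg hδ.le]
      have : (δ * ‖w‖) ^ 2 + δ ^ 2 = δ ^ 2 * (‖w‖ ^ 2 + 1) := by ring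
      rw [this]
      field_simp
    simp only [Complex.real_smul]
    rw [← e]
    push_cast
    ring
  simp only [hchange]
  have hlimit : (Real.pi : ℂ) * F z = ∫ w : ℂ, F z * ((((‖w‖ ^ 2 + 1) ^ 2)⁻¹ : ℝ) : ℂ) := by
    rw [integral_const_mul, integral_complex_ofReal, integral_inv_one_add_normSq_sq, mul_comm]
  rw [hlimit]
  have hcont : Continuous fun w : ℂ => (‖w‖ ^ 2 + 1 : ℝ) ^ 2 := by fun_prop
  have hcont' : Continuous fun w : ℂ => ((((‖w‖ ^ 2 + 1) ^ 2)⁻¹ : ℝ) : ℂ) :=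
    Complex.continuous_ofReal.comp (hcont.inv₀ fun w => by positivity)
  refine tendsto_integral_of_dominated_convergence (fun w => C * ((‖w‖ ^ 2 + 1) ^ 2)⁻¹)
    (fun N => ?_) (integrable_inv_one_add_normSq_sq.const_mul C) (fun N => ?_) ?_
  · have h1 : Continuous fun w : ℂ => z - (1 / ((N : ℝ) + 1)) • w :=
      continuous_const.sub (continuous_const_smul _)
    exact ((hF.comp h1).mul hcont').aestronglyMeasurable
  · refine Filter.Eventually.of_forall fun w => ?_
    rw [norm_mul, Complex.norm_real, Real.norm_of_nonneg (by positivity)]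
    gcongr
    exact hC _
  · refine Filter.Eventually.of_forall fun w => ?_
    have h0 : Filter.Tendsto (fun N : ℕ => z - (1 / ((N : ℝ) + 1)) • w) Filter.atTop (nhds z) := by
      simpa using ((tendsto_one_div_add_atTop_nhds_zero_nat (𝕜 := ℝ)).smul_const w).const_sub z
    exact ((hF.tendsto z).comp h0).mul_const _

/-- The Cauchy–Pompeiu formula for `h_{j,k} e^{-|z|²}`, whose `∂̄`-derivative is
`-h_{j+1,k} e^{-|z|²}`: let `ε → 0` in the identity for the mollified kernel. -/
theorem cauchyTransform_itoPoly_succ (j k : ℕ) (z : ℂ) :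
    cauchyTransform (itoPoly (j + 1) k) z = -(itoPoly j k z * gaussC 1 z) := by
  obtain ⟨C, -, hC⟩ := (expGrowth_itoPoly j k).norm_mul_gaussC_bounded
  obtain ⟨M, hM⟩ := (expGrowth_itoPoly (j + 1) k).cauchy_bound
  have hcF : ∀ j, Continuous fun ξ => itoPoly j k ξ * gaussC 1 ξ := fun j =>
    (continuous_itoPoly j k).mul (continuous_gaussC 1)
  have t1 := tendsto_integral_poisson (hcF j) hC z
  have t2 : Filter.Tendsto (fun N : ℕ => ∫ ξ, itoPoly (j + 1) k ξ * gaussC 1 ξ *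
      ((starRingEnd ℂ) (z - ξ) * (((‖z - ξ‖ ^ 2 + (1 / ((N : ℝ) + 1)) ^ 2)⁻¹ : ℝ) : ℂ)))
      Filter.atTop (nhds (∫ ξ, itoPoly (j + 1) k ξ * gaussC 1 ξ * (z - ξ)⁻¹)) := by
    refine tendsto_integral_of_dominated_convergence _ (fun N => ?_) (hM z).2.1 (fun N => ?_) ?_
    · refine ((hcF (j + 1)).mul (Continuous.mul (by fun_prop) ?_)).aestronglyMeasurable
      exact continuous_iff_continuousAt.2 fun ξ =>
        (hasWirtingerAt_inv_normSq_add (by positivity) z ξ).continuousAt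
    · refine Filter.Eventually.of_forall fun ξ => ?_
      rw [norm_mul]
      gcongr
      rw [norm_mul, RCLike.norm_conj, Complex.norm_real, Real.norm_of_nonneg (by positivity)]
      rcases (norm_nonneg (z - ξ)).eq_or_lt with h0 | h0
      · rw [← h0]; simp
      · rw [← div_eq_mul_inv, div_le_iff₀ (by positivity), ← div_eq_inv_mul, le_div_iff₀ h0]
        nlinarith [sq_nonneg (1 / ((N : ℝ) + 1))]
    · refine Filter.Eventually.of_forall fun ξ => Filter.Tendsto.const_mul _ ?_
      -- at `ξ = z` both kernels are `0`, by the convention `0⁻¹ = 0`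
      by_cases h0 : z - ξ = 0
      · simp [h0]
      · have hpos : 0 < ‖z - ξ‖ ^ 2 := by positivity
        have t := ((tendsto_one_div_add_atTop_nhds_zero_nat (𝕜 := ℝ)).pow 2).const_add
          (‖z - ξ‖ ^ 2)
        have t' := (t.inv₀ (by simpa using h0))
        have t'' := ((Complex.continuous_ofReal.tendsto _).comp t').const_mul
          ((starRingEnd ℂ) (z - ξ))
        refine t''.trans (le_of_eq ?_)
        congr 1
        have h1 : ((‖z - ξ‖ ^ 2 : ℝ) : ℂ) = (z - ξ) * (starRingEnd ℂ) (z - ξ) := by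
          rw [Complex.mul_conj, Complex.normSq_eq_norm_sq]
        have h2 : (starRingEnd ℂ) (z - ξ) ≠ 0 := (map_ne_zero _).2 h0
        rw [zero_pow two_ne_zero, add_zero, Complex.ofReal_inv, h1]
        field_simp
  have e : ∀ N : ℕ, _ = _ := fun N =>
    integral_itoPoly_mollified (ε := (1 / ((N : ℝ) + 1)) ^ 2) (by positivity) j k z
  simp only [e] at t2
  have hval := tendsto_nhds_unique t2 t1.neg
  rw [cauchyTransform, integral_gaussianMeasureC]
  have e3 : ∀ ξ, itoPoly (j + 1) k ξ / (z - ξ) * gaussC 1 ξ =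
      itoPoly (j + 1) k ξ * gaussC 1 ξ * (z - ξ)⁻¹ := fun ξ => by ring
  simp only [e3]
  rw [hval]
  have : (Real.pi : ℂ) ≠ 0 := by exact_mod_cast Real.pi_ne_zero
  field_simp

/-! ### Coefficients of the Cauchy transform -/

theorem integral_gaussianMeasureC_rotation (a : Circle) (g : ℂ → ℂ) :
    ∫ z, g (a * z) ∂gaussianMeasureC = ∫ z, g z ∂gaussianMeasureC := by
  rw [integral_gaussianMeasureC, integral_gaussianMeasureC]
  have h := (rotation a).measurePreserving.integral_comp
    (rotation a).toHomeomorph.measurableEmbedding (fun z => g z * gaussC 1 z)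
  rw [← h]
  refine integral_congr_ae (Filter.Eventually.of_forall fun z => ?_)
  have : ‖(a : ℂ) * z‖ = ‖z‖ := by rw [norm_mul, Circle.norm_coe, one_mul]
  simp only [gaussC, rotation_apply, this]

/-- The Cauchy transform lowers the rotation weight by one. -/
theorem cauchyTransform_itoPoly_zero_left_rotation (a : Circle) (k : ℕ) (z : ℂ) :
    cauchyTransform (itoPoly 0 k) (a * z) =
      (starRingEnd ℂ) a ^ (k + 1) * cauchyTransform (itoPoly 0 k) z := by
  have ha : (a : ℂ) * (starRingEnd ℂ) (a : ℂ) = 1 := by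
    rw [Complex.mul_conj]; simp
  have h1 := integral_gaussianMeasureC_rotation a (fun ξ => itoPoly 0 k ξ / (a * z - ξ))
  have h2 : ∀ ξ, itoPoly 0 k (a * ξ) / (a * z - a * ξ) =
      (starRingEnd ℂ) a ^ (k + 1) * (itoPoly 0 k ξ / (z - ξ)) := fun ξ => by
    simp only [itoPoly_zero_left, map_mul, mul_pow]
    rw [← mul_sub, eq_inv_of_mul_eq_one_right ha, pow_succ, div_eq_mul_inv, mul_inv]
    ring
  simp only [h2] at h1
  rw [cauchyTransform, cauchyTransform, ← h1, integral_const_mul]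
  ring

theorem integral_cauchyTransform_itoPoly_zero_zero (k m : ℕ) :
    ∫ z, cauchyTransform (itoPoly 0 k) z * itoPoly 0 m z ∂gaussianMeasureC = 0 := by
  -- rotate by a `(k + m + 1)`-th root of `-1`
  let a : Circle := Circle.exp (Real.pi / (k + m + 1 : ℕ))
  have ha : (starRingEnd ℂ) (a : ℂ) ^ (k + m + 1) = -1 := by
    have h0 : ((k + m + 1 : ℕ) : ℂ) ≠ 0 := by exact_mod_cast Nat.succ_ne_zero (k + m)
    rw [← map_pow, Circle.coe_exp, ← Complex.exp_nat_mul]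
    have : ((k + m + 1 : ℕ) : ℂ) * (((Real.pi / (k + m + 1 : ℕ) : ℝ) : ℂ) * Complex.I) =
        Real.pi * Complex.I := by
      rw [Complex.ofReal_div, Complex.ofReal_natCast]
      field_simp
    rw [this, Complex.exp_pi_mul_I]
    simp
  have h := integral_gaussianMeasureC_rotation a
    (fun z => cauchyTransform (itoPoly 0 k) z * itoPoly 0 m z)
  have e : ∀ z, cauchyTransform (itoPoly 0 k) (a * z) * itoPoly 0 m (a * z) =
      -1 * (cauchyTransform (itoPoly 0 k) z * itoPoly 0 m z) := fun z => by
    rw [cauchyTransform_itoPoly_zero_left_rotation, ← ha]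
    simp only [itoPoly_zero_left, map_mul, mul_pow]
    ring
  simp only [e] at h
  rw [integral_const_mul] at h
  linear_combination (-1 / 2) * h

theorem integral_cauchyTransform_itoPoly_succ_left (j k n m : ℕ) :
    ∫ z, cauchyTransform (itoPoly (j + 1) k) z * itoPoly n m z ∂gaussianMeasureC =
      -itoPairing 2 j k n m := by
  rw [integral_gaussianMeasureC, itoPairing, ← integral_neg]
  refine integral_congr_ae (Filter.Eventually.of_forall fun z => ?_)
  simp only [cauchyTransform_itoPoly_succ]
  have : gaussC 2 z = gaussC 1 z * gaussC 1 z := by rw [← gaussC_add]; norm_num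
  rw [this]
  ring

theorem integral_cauchyTransform_itoPoly_succ_right (k n m : ℕ) :
    ∫ z, cauchyTransform (itoPoly 0 k) z * itoPoly (n + 1) m z ∂gaussianMeasureC =
      itoPairing 2 0 k n m := by
  rw [integral_cauchyTransform_mul (expGrowth_itoPoly _ _) (expGrowth_itoPoly _ _), itoPairing_comm]
  have := integral_cauchyTransform_itoPoly_succ_left n m 0 k
  simp only [mul_comm (cauchyTransform _ _)] at this
  rw [this, neg_neg]

/-- The bilinear pairing of `C h_{j,k}` with `h_{n,m}`, the conjugate of `h_{m,n}`. -/
theorem integral_cauchyTransform_itoPoly (j k n m : ℕ) :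
    ∫ z, cauchyTransform (itoPoly j k) z * itoPoly n m z ∂gaussianMeasureC =
      if n + j = k + m + 1 then
        ((-1) ^ (n + k + 1) * (k + m).factorial * Real.pi / 2 ^ (n + j) : ℂ) else 0 := by
  rcases j with _ | j
  · rcases n with _ | n
    · rw [integral_cauchyTransform_itoPoly_zero_zero, if_neg (by omega)]
    · rw [integral_cauchyTransform_itoPoly_succ_right, itoPairing_two]
      by_cases h : n = k + m
      · rw [if_pos (by omega), if_pos (by omega), zero_add, h, div_pow]
        have : (-1 : ℂ) ^ (k + m) * (-1) ^ (k + m) = 1 := by rw [← mul_pow]; simp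
        rw [show k + m + 1 + k + 1 = 2 + (k + (k + m)) by ring,
          show k + m + 1 + 0 = k + m + 1 by ring]
        simp only [pow_add, zero_add]
        ring
      · rw [if_neg (by omega), if_neg (by omega)]
  · rw [integral_cauchyTransform_itoPoly_succ_left, itoPairing_two]
    by_cases h : j + n = k + m
    · rw [if_pos h, if_pos (by omega), div_pow]
      have h2 : (-1 : ℂ) ^ j * (-1) ^ j = 1 := by rw [← mul_pow]; simp
      rw [show n + (j + 1) = k + m + 1 by omega, h, ← h]
      simp only [pow_add]
      linear_combination (-((-1) ^ n * (-1) ^ k * (j + n).factorial * Real.pi /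
        (2 ^ j * 2 ^ n * 2)) : ℂ) * h2
    · rw [if_neg h, if_neg (by omega), neg_zero]

theorem mainTheorem1 (n j k : ℕ) :
    MemLp (itoHermite j k) 2 gaussianMeasureC ∧
    (∀ z : ℂ, Integrable (fun ξ => itoHermite j k ξ / (z - ξ)) gaussianMeasureC) ∧
    ∃ hC : MemLp (cauchyTransform (itoHermite j k)) 2 gaussianMeasureC,
      (k + 1 ≤ n + j →
        polyBargmannProj n (hC.toLp (cauchyTransform (itoHermite j k))) =ᵐ[gaussianMeasureC]
          fun z => ((-1 : ℂ) ^ (n + k + 1) * (Nat.factorial (n + j - 1) : ℂ) /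
            ((2 : ℂ) ^ (n + j) * (Nat.factorial n : ℂ) * (Nat.factorial (n + j - k - 1) : ℂ))) *
              itoHermite (n + j - k - 1) n z) ∧
      (¬ k + 1 ≤ n + j →
        polyBargmannProj n (hC.toLp (cauchyTransform (itoHermite j k))) = 0) := by
  simp only [itoHermite_eq_itoPoly]
  obtain ⟨_, hM⟩ := (expGrowth_itoPoly j k).cauchy_bound
  refine ⟨(expGrowth_itoPoly j k).memLp, fun z => (hM z).1,
    (expGrowth_itoPoly j k).memLp_cauchyTransform, fun h => ?_, fun h => ?_⟩
  · obtain ⟨M, hMdef⟩ : ∃ M, n + j = k + M + 1 := ⟨n + j - k - 1, by omega⟩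
    rw [show n + j - k - 1 = M by omega, show n + j - 1 = k + M by omega]
    set c : ℂ := (-1 : ℂ) ^ (n + k + 1) * ((k + M).factorial : ℂ) /
      ((2 : ℂ) ^ (n + j) * (n.factorial : ℂ) * (M.factorial : ℂ)) with hc
    have hP : polyBargmannProj n ((expGrowth_itoPoly j k).memLp_cauchyTransform.toLp
        (cauchyTransform (itoPoly j k))) = c • itoLp M n := by
      refine polyBargmannProj_eq_of_inner_eq
        (Submodule.smul_mem _ c (itoLp_mem_polyBargmann M n)) fun m => ?_
      rw [inner_itoLp_toLp, integral_cauchyTransform_itoPoly, inner_smul_right, inner_itoLp_itoLp]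
      by_cases hm : M = m
      · subst hm
        rw [if_pos hMdef, if_pos ⟨rfl, rfl⟩, hc]
        have h1 : (n.factorial : ℂ) ≠ 0 := by exact_mod_cast n.factorial_ne_zero
        have h2 : (M.factorial : ℂ) ≠ 0 := by exact_mod_cast M.factorial_ne_zero
        field_simp
      · rw [if_neg (by omega), if_neg (by tauto), mul_zero]
    rw [hP]
    filter_upwards [Lp.coeFn_smul c (itoLp M n), coeFn_itoLp M n] with z h1 h2
    rw [h1, Pi.smul_apply, h2, smul_eq_mul]
  · refine polyBargmannProj_eq_of_inner_eq (Submodule.zero_mem _) fun m => ?_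
    rw [inner_itoLp_toLp, integral_cauchyTransform_itoPoly, inner_zero_right, if_neg (by omega)]
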